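/- A polytope in $\mathbb R^d$ is the convex hull of finitely many points (at least one); its faces are the sets $P^c$ of maximizers of linear functionals $c$ on $P$; $V(P)$ and $E(P)$ are its sets of vertices and edges. A deformation of the framework (vertices and edges) of $P$ is a map $\psi:V(P)\to\mathbb R^d$ such that for each edge $uv$ there is $\lambda_{uv}\ge 0$ with $\psi(v)-\psi(u)=\lambda_{uv}(v-u)$; the vector $\lambda\in\mathbb R_{\ge0}^{E(P)}$ is its edge-deformation vector. The deformation cone $\mathrm{DC}(P)\subseteq\mathbb R^{E(P)}$ is the set of all edge-deformation vectors of deformations. The edge-dependency graph $\mathrm{ED}(P)$ has node set $E(P)$, with an arc (possibly a loop) between $e$ and $f$ if $\lambda_e=\lambda_f$ for all $\lambda\in\mathrm{DC}(P)$. A vector is 2-generic with respect to $P$ if it is not parallel to any 2-dimensional face of $P$. Polytopes $P,Q$ are in parallelogramic position if every edge direction of $P$ is 2-generic with respect to $Q$, every edge direction of $Q$ is 2-generic with respect to $P$, and no edge of $P$ is parallel to an edge of $Q$ (the last condition follows from the other two unless $P$ and $Q$ are both segments). For an edge $e$ of $P$ (resp. $Q$), the edge class $C_e$ is the set of edges of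 $P+Q$ of the form $e+x$ with $x$ a vertex of $Q$ (resp. $P$). **Theorem.** Let $P,Q\subset\mathbb R^d$ be polytopes in parallelogramic position. Then $\mathrm{DC}(P+Q)$ is linearly isomorphic to $\mathrm{DC}(P)\times \mathrm{DC}(Q)$. Moreover, the edge classes are nonempty, are distinct for distinct elements of $E(P)\sqcup E(Q)$, and are the equivalence classes of an equivalence relation on $E(P+Q)$; and $\mathrm{ED}(P+Q)$ is the lift of the disjoint union $\mathrm{ED}(P)\sqcup \mathrm{ED}(Q)$ for this relation: for $g\in C_e$ and $h\in C_f$, there is an arc between $g$ and $h$ in $\mathrm{ED}(P+Q)$ if and only if $e,f$ are both edges of $P$ and joined by an arc in $\mathrm{ED}(P)$, or both edges of $Q$ and joined by an arc in $\mathrm{ED}(Q)$. A polytope $Q$ is a deformation of a polytope $P$ if $P=\lambda Q+R$ for some $\lambda>0$ and some polytope $R$; its edge-deformation vector is that of the map sending each vertex $v$ of $P$ to the vertex $Q^c$ of $Q$, for any $c$ with $P^c=\{v\}$. A polytope $P$ is indecomposable if it is not a single point and all its deformations are of the form $\lambda P+t$ with $\lambda\ge0$, $t\in\mathbb R^d$.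 Polytopes $P_1,\dots,P_r$ are in parallelogramic position if $P_i$ and $\sum_{j\ne i}P_j$ are in parallelogramic position for each $i$ (an empty sum being $\{0\}$). **Corollary.** Let $P_1,\dots,P_r$ be indecomposable polytopes in $\mathbb R^d$ in parallelogramic position, and let $S=P_1+\dots+P_r$. Then $\mathrm{DC}(S)$ is simplicial of dimension $r$: each $P_i$ is a deformation of $S$, and the edge-deformation vectors of $P_1,\dots,P_r$ are linearly independent and span the $r$ rays of $\mathrm{DC}(S)$. Up to translation, every deformation $Q$ of $S$ is uniquely a Minkowski sum of indecomposable polytopes, which are dilations of $P_1,\dots,P_r$: there are unique $c_1,\dots,c_r\ge0$ such that $Q=\sum_i c_iP_i+t$ for some $t$; $c_iP_i$ is indecomposable if $c_i>0$; and whenever $Q=\sum_{j=1}^m R_j+t$ with all $R_j$ indecomposable, each $R_j$ is a translate of $\mu_jP_{\sigma(j)}$ for some $\mu_j>0$ and $\sigma(j)\in\{1,\dots,r\}$, with $\sum_{j:\sigma(j)=i}\mu_j=c_i$ for every $i$ (so the decomposition is unique once summands that are translated dilates of each other are merged). -/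

import Mathlib

open scoped Pointwise

namespace PolytopeDeformation

variable {W : Type*} [NormedAddCommGroup W] [NormedSpace ℝ W]

/-! ### Polytopes, faces, vertices, edges -/

/-- A (nonempty) polytope: the convex hull of finitely many points. -/
def IsPolytope (P : Set W) : Prop :=
  ∃ s : Set W, s.Finite ∧ s.Nonempty ∧ P = convexHull ℝ s

/-- The face `P^c` of `P` on which the linear functional `c` is maximal. -/
def maxFace (P : Set W) (c : StrongDual ℝ W) : Set W :=
  {x ∈ P | ∀ y ∈ P, c y ≤ c x}

/-- The vertices of `P`: the points `v` such that `{v}` is a face `P^c`. The (nonempty) faces of `P`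
are its exposed subsets, in the sense of `IsExposed`. -/
abbrev Vertex (P : Set W) : Type _ := {v : W // v ∈ P.exposedPoints ℝ}

/-- The graph of `P`: two distinct vertices are adjacent when the segment between them is
a face, that is, an edge of the polytope. Together with the inclusion `Vertex P → W` it is the
framework of `P`; all of its edges are non-degenerate. -/
def edgeGraph (P : Set W) : SimpleGraph (Vertex P) where
  Adj u v := u ≠ v ∧ IsExposed ℝ P (segment ℝ (u : W) (v : W))
  symm := ⟨fun u v h => ⟨h.1.symm, by rw [segment_symm]; exact h.2⟩⟩
  loopless := ⟨fun _ h => h.1 rfl⟩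

/-- The edges of `P`, as unordered pairs of vertices. -/
abbrev Edge (P : Set W) : Type _ := {e : Sym2 (Vertex P) // e ∈ (edgeGraph P).edgeSet}

/-- The edge `{u, v}`. -/
def mkEdge {P : Set W} {u v : Vertex P} (h : (edgeGraph P).Adj u v) : Edge P :=
  ⟨s(u, v), h⟩

/-- The segment in `W` underlying an edge. -/
def Edge.toSet {P : Set W} (e : Edge P) : Set W :=
  convexHull ℝ {x : W | ∃ v ∈ e.1, x = (v : W)}

/-- A 2-face: a face of dimension two. -/
def IsTwoFace (P F : Set W) : Prop :=
  IsExposed ℝ P F ∧ Module.finrank ℝ (vectorSpan ℝ F) = 2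

/-! ### Parallelogramic position -/

/-- `w` is 2-generic with respect to `P`: it is not parallel to any 2-face of `P`. -/
def IsTwoGeneric (P : Set W) (w : W) : Prop :=
  ∀ F : Set W, IsTwoFace P F → w ∉ vectorSpan ℝ F

/-- Parallelogramic position. The third clause (no edge of `P` is parallel to an edge of `Q`) is a
consequence of the first two, except when `P` and `Q` are both segments. -/
def ParallelogramicPosition (P Q : Set W) : Prop :=
  (∀ u v : Vertex P, (edgeGraph P).Adj u v → IsTwoGeneric Q ((v : W) - u)) ∧
  (∀ x y : Vertex Q, (edgeGraph Q).Adj x y → IsTwoGeneric P ((y : W) - x)) ∧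
  (∀ u v : Vertex P, (edgeGraph P).Adj u v → ∀ x y : Vertex Q, (edgeGraph Q).Adj x y →
    ¬ ∃ t : ℝ, (v : W) - u = t • ((y : W) - x))

/-- A finite family is in parallelogramic position if each member is in parallelogramic
position with the Minkowski sum of all the others. -/
def FamilyParallelogramicPosition {r : ℕ} (P : Fin r → Set W) : Prop :=
  ∀ i, ParallelogramicPosition (P i) (∑ j ∈ Finset.univ.erase i, P j)

/-! ### Deformations, deformation cones -/

/-- `lam` is the edge-deformation vector of the deformation `ψ` of the framework of `P`. -/
def IsFrameworkDeformation (P : Set W) (ψ : Vertex P → W) (lam : Edge P → ℝ) : Prop :=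
  (∀ e, 0 ≤ lam e) ∧
  ∀ (u v : Vertex P) (h : (edgeGraph P).Adj u v),
    lam (mkEdge h) • ((v : W) - u) = ψ v - ψ u

/-- The (edge-)deformation cone of `P`: the set of the edge-deformation vectors of all
deformations of its framework. -/
def defoCone (P : Set W) : PointedCone ℝ (Edge P → ℝ) where
  carrier := {lam | ∃ ψ, IsFrameworkDeformation P ψ lam}
  zero_mem' := ⟨fun _ => 0, fun _ => le_rfl, fun _ _ _ => by simp⟩
  add_mem' := by
    rintro a b ⟨ψ, h1, h2⟩ ⟨ω, h3, h4⟩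
    refine ⟨fun v => ψ v + ω v, fun e => add_nonneg (h1 e) (h3 e), fun u v h => ?_⟩
    rw [Pi.add_apply, add_smul, h2 u v h, h4 u v h, add_sub_add_comm]
  smul_mem' := by
    rintro ⟨c, hc⟩ a ⟨ψ, h1, h2⟩
    refine ⟨fun v => c • ψ v, fun e => mul_nonneg hc (h1 e), fun u v h => ?_⟩
    have : ((⟨c, hc⟩ : {c : ℝ // 0 ≤ c}) • a) (mkEdge h) = c * a (mkEdge h) := rfl
    rw [this, mul_smul, h2 u v h, smul_sub]

/-- `Q` is a deformation (weak Minkowski summand) of the polytope `P`. -/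
def IsDeformation (P Q : Set W) : Prop :=
  IsPolytope Q ∧ ∃ R : Set W, IsPolytope R ∧ ∃ c : ℝ, 0 < c ∧ P = c • Q + R

/-- A polytope, not a single point, whose only deformations are its translated dilates. -/
def IsIndecomposable (P : Set W) : Prop :=
  IsPolytope P ∧ P.Nontrivial ∧
    ∀ Q : Set W, IsDeformation P Q → ∃ c : ℝ, 0 ≤ c ∧ ∃ t : W, Q = c • P + {t}

/-- `lam` is the edge-deformation vector `λ_P(Q)` of a deformation `Q` of the polytope `P`: the
underlying framework deformation sends the vertex `P^c = {v}` of `P` to the vertex `Q^c`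
of `Q`. -/
def IsEdgeDeformationVector (P Q : Set W) (lam : Edge P → ℝ) : Prop :=
  ∃ f : Vertex P → W,
    (∀ (v : Vertex P) (c : StrongDual ℝ W), maxFace P c = {(v : W)} → maxFace Q c = {f v}) ∧
    IsFrameworkDeformation P f lam

/-- Two cones are linearly isomorphic: some linear isomorphism between their linear spans maps the
first cone onto the second. -/
def ConesLinearlyIsomorphic {V V' : Type*} [AddCommGroup V] [Module ℝ V] [AddCommGroup V']
    [Module ℝ V'] (C : PointedCone ℝ V) (D : PointedCone ℝ V') : Prop :=
  ∃ f : Submodule.span ℝ (C : Set V) ≃ₗ[ℝ] Submodule.span ℝ (D : Set V'),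
    ∀ x : Submodule.span ℝ (C : Set V), (x : V) ∈ C ↔ (f x : V') ∈ D

/-! ### Graphs with loops, the graph of edge dependencies, lifts -/

/-- Undirected graphs, loops allowed, with node set `N`. -/
structure LoopGraph (N : Type*) where
  Arc : N → N → Prop
  symm : ∀ {a b}, Arc a b → Arc b a

/-- The graph of edge dependencies of a polytope. -/
def dependencyGraph (P : Set W) : LoopGraph (Edge P) where
  Arc e f := ∀ lam ∈ defoCone P, lam e = lam f
  symm h lam hl := (h lam hl).symm

/-- The disjoint union of two graphs. -/
def LoopGraph.union {N M : Type*} (G : LoopGraph N) (H : LoopGraph M) : LoopGraph (N ⊕ M) where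
  Arc := Sum.LiftRel G.Arc H.Arc
  symm h := by
    cases h with
    | inl h => exact .inl (G.symm h)
    | inr h => exact .inr (H.symm h)

/-- Renaming of nodes along a bijection. -/
def LoopGraph.relabel {N M : Type*} (φ : N ≃ M) (G : LoopGraph M) : LoopGraph N where
  Arc a b := G.Arc (φ a) (φ b)
  symm h := G.symm h

/-- The lift of a graph on the quotient `N/∼` to a graph on `N`. -/
def LoopGraph.lift {N : Type*} (s : Setoid N) (G : LoopGraph (Quotient s)) : LoopGraph N where
  Arc a b := G.Arc (Quotient.mk s a) (Quotient.mk s b)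
  symm h := G.symm h

/-- The edge class in `P + Q` of an edge `e` of `P` or of `Q`: all edges of `P + Q` of the form
`e + x`, where `x` is a vertex of `Q`, respectively of `P`. -/
def edgeClass (P Q : Set W) : Edge P ⊕ Edge Q → Set (Edge (P + Q))
  | .inl e => {g | ∃ x : Vertex Q, g.toSet = e.toSet + {(x : W)}}
  | .inr e => {g | ∃ x : Vertex P, g.toSet = {(x : W)} + e.toSet}

end PolytopeDeformation

open PolytopeDeformation

namespace PolytopeDeformation

open Filter Topology

variable {W : Type*} [NormedAddCommGroup W] [NormedSpace ℝ W]

/-! ### Faces and vertices of polytopes -/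

/-! Up to translation, a framework deformation amounts to its edge jumps `ψ v - ψ u`. An edge of `P
+ Q` is `e + x` or `u + f`: if a functional had edges in its faces of both summands, these would be
parallel (`Transverse.edge_cases`). The core is `Transverse.jump_eq`: all edges of a class `C_e`
have the same jump. The functionals exposing `e` form a convex set, so two of them, exposing
vertices `x` and `y` of `Q`, are joined by a segment. 2-genericity of `e` ensures that a face of `Q`
which is neither a vertex nor an edge has two differences independent modulo `e`. Meeting such a
face imposes two conditions, and a generic segment avoids them all. It therefore only crosses edges
`f` of `Q`, and each crossing is a parallelogram `e + f`, whose closing condition forces equal jumps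
on opposite sides.

The jumps thus descend to the edges of `P`. To integrate them, `IsPolytope.exists_potential` shows
that closing on 2-faces suffices: vertices are added from the top down along a generic functional,
and consistency at a new vertex follows from connectedness of an open half-space part of its vertex
figure, whose edges are 2-faces. The condition on a 2-face `F` holds because 2-genericity of the
edges of `Q` gives a vertex `x` with `F + x` a face of `P + Q`, where `ψ` itself is a potential.
Conversely, deformations of `P` and `Q` add up. Hence the cone of `P + Q` is the pullback of the
product cone along the class map, which also yields the dependency graph.

For the corollary, framework deformations and weak Minkowski summands are matched by
`IsDefo.isDeformation_defoHull` and `IsDeformation.exists_vertexMap`, so an indecomposable `P i`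
only has the deformations `v ↦ c • v + t`. Splitting each `P i` off the sum, a deformation of the
sum is a nonnegative combination of the vertex maps of the `P i`, plus a constant. An edge
contributed by `P i` alone reads off its coefficient, whence independence and uniqueness. -/

lemma maxFace_subset (P : Set W) (c : StrongDual ℝ W) : maxFace P c ⊆ P := fun _ h => h.1

lemma mem_exposedPoints_iff {P : Set W} {v : W} :
    v ∈ P.exposedPoints ℝ ↔ ∃ c, maxFace P c = {v} := by
  constructor
  · rintro ⟨hv, c, hc⟩
    refine ⟨c, Set.eq_singleton_iff_unique_mem.2 ⟨⟨hv, fun y hy => (hc y hy).1⟩, ?_⟩⟩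
    exact fun x hx => (hc x hx.1).2 (hx.2 v hv)
  · rintro ⟨c, hc⟩
    have hv : v ∈ maxFace P c := hc ▸ rfl
    refine ⟨hv.1, c, fun y hy => ⟨hv.2 y hy, fun h => ?_⟩⟩
    have : y ∈ maxFace P c := ⟨hy, fun z hz => (hv.2 z hz).trans h⟩
    rwa [hc] at this

lemma maxFace_eq_of_subset {P F : Set W} {h : StrongDual ℝ W} (hF : F ⊆ P)
    (hne : (maxFace P h).Nonempty) (hs : maxFace P h ⊆ F) : maxFace P h = maxFace F h := by
  obtain ⟨z, hz⟩ := hne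
  ext x
  refine ⟨fun hx => ⟨hs hx, fun y hy => hx.2 y (hF hy)⟩, fun hx => ⟨hF hx.1, fun y hy => ?_⟩⟩
  exact (hz.2 y hy).trans (hx.2 z (hs hz))

lemma maxFace_convexHull {s : Set W} {c : StrongDual ℝ W} {a : ℝ} (hle : ∀ v ∈ s, c v ≤ a)
    (hex : ∃ v ∈ s, c v = a) :
    maxFace (convexHull ℝ s) c = convexHull ℝ {v ∈ s | c v = a} := by
  have hle' : ∀ y ∈ convexHull ℝ s, c y ≤ a := fun y hy =>
    convexHull_min (t := {y | c y ≤ a}) hle (convex_halfSpace_le c.isLinear a) hy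
  obtain ⟨v0, hv0, rfl⟩ := hex
  ext x
  constructor
  · rintro ⟨hx, hmax⟩
    have hcx : c x = c v0 := le_antisymm (hle' x hx) (hmax v0 (subset_convexHull ℝ s hv0))
    have hs : s = {v ∈ s | c v = c v0} ∪ {v ∈ s | c v < c v0} := by
      ext y
      constructor
      · intro hy
        rcases (hle y hy).eq_or_lt with h | h
        exacts [.inl ⟨hy, h⟩, .inr ⟨hy, h⟩]
      · rintro (h | h) <;> exact h.1
    rcases Set.eq_empty_or_nonempty {v ∈ s | c v < c v0} with hB | hB
    · rw [hB, Set.union_empty] at hs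
      rwa [← hs]
    · have hA : {v ∈ s | c v = c v0}.Nonempty := ⟨v0, hv0, rfl⟩
      rw [hs, convexHull_union hA hB] at hx
      obtain ⟨p, hp, q, hq, hpq⟩ := mem_convexJoin.1 hx
      have hcq : c q < c v0 :=
        convexHull_min (t := {y | c y < c v0}) (fun y hy => hy.2)
          (convex_halfSpace_lt c.isLinear _) hq
      have hcp : c p = c v0 :=
        convexHull_min (t := {y | c y = c v0}) (fun y hy => hy.2)
          (convex_hyperplane c.isLinear _) hp
      obtain ⟨α, β, hα, hβ, hab, rfl⟩ := hpq
      rw [map_add, map_smul, map_smul, smul_eq_mul, smul_eq_mul, hcp] at hcx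
      have hb : β * (c v0 - c q) = 0 := by
        have : α = 1 - β := by linarith
        subst this
        linarith
      rcases mul_eq_zero.1 hb with h | h
      · subst h
        have : α = 1 := by linarith
        subst this
        simpa using hp
      · linarith
  · intro hx
    have hcx : c x = c v0 :=
      convexHull_min (t := {y | c y = c v0}) (fun y hy => hy.2)
        (convex_hyperplane c.isLinear _) hx
    exact ⟨convexHull_mono (fun y hy => hy.1) hx, fun y hy => (hle' y hy).trans hcx.ge⟩

lemma maxFace_singleton (v : W) (c : StrongDual ℝ W) : maxFace {v} c = {v} := by
  ext x
  simp only [maxFace, Set.mem_singleton_iff, forall_eq, Set.mem_ofPred_eq]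
  exact ⟨fun h => h.1, fun h => ⟨h, h ▸ le_rfl⟩⟩

lemma IsPolytope.singleton (v : W) : IsPolytope ({v} : Set W) :=
  ⟨{v}, Set.finite_singleton v, Set.singleton_nonempty v, by simp⟩

lemma IsPolytope.nonempty {P : Set W} (h : IsPolytope P) : P.Nonempty := by
  obtain ⟨s, -, hn, rfl⟩ := h
  exact hn.convexHull

lemma IsPolytope.convex {P : Set W} (h : IsPolytope P) : Convex ℝ P := by
  obtain ⟨s, -, -, rfl⟩ := h
  exact convex_convexHull ℝ s

lemma IsPolytope.isCompact {P : Set W} (h : IsPolytope P) : IsCompact P := by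
  obtain ⟨s, hf, -, rfl⟩ := h
  exact hf.isCompact_convexHull ℝ

lemma exists_max_of_finite {s : Set W} (hs : s.Finite) (hn : s.Nonempty) (c : StrongDual ℝ W) :
    ∃ v ∈ s, ∀ w ∈ s, c w ≤ c v :=
  s.exists_max_image c hs hn

lemma IsPolytope.face {P : Set W} (h : IsPolytope P) (c : StrongDual ℝ W) :
    IsPolytope (maxFace P c) := by
  obtain ⟨s, hf, hn, rfl⟩ := h
  obtain ⟨v, hv, hmax⟩ := exists_max_of_finite hf hn c
  rw [maxFace_convexHull (a := c v) hmax ⟨v, hv, rfl⟩]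
  exact ⟨{w ∈ s | c w = c v}, hf.subset fun x hx => hx.1, ⟨v, hv, rfl⟩, rfl⟩

lemma exposedPoints_convexHull_subset {s : Set W} (hf : s.Finite) (hn : s.Nonempty) :
    (convexHull ℝ s).exposedPoints ℝ ⊆ s := by
  intro x hx
  obtain ⟨c, hc⟩ := mem_exposedPoints_iff.1 hx
  obtain ⟨v, hv, hmax⟩ := exists_max_of_finite hf hn c
  rw [maxFace_convexHull (a := c v) hmax ⟨v, hv, rfl⟩] at hc
  have : v ∈ ({x} : Set W) := hc ▸ subset_convexHull ℝ _ ⟨hv, rfl⟩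
  rw [Set.mem_singleton_iff] at this
  exact this ▸ hv

lemma mem_exposedPoints_of_notMem {s : Set W} (hf : s.Finite) {p : W} (hp : p ∈ s)
    (h : p ∉ convexHull ℝ (s \ {p})) : p ∈ (convexHull ℝ s).exposedPoints ℝ := by
  obtain ⟨f, u, h1, h2⟩ := geometric_hahn_banach_closed_point (convex_convexHull ℝ (s \ {p}))
    ((hf.subset Set.sdiff_subset).isCompact_convexHull ℝ).isClosed h
  have h3 : ∀ v ∈ s, v ≠ p → f v < f p := fun v hv hvp =>
    (h1 v (subset_convexHull ℝ _ ⟨hv, hvp⟩)).trans h2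
  refine mem_exposedPoints_iff.2 ⟨f, ?_⟩
  rw [maxFace_convexHull (a := f p) (fun v hv => ?_) ⟨p, hp, rfl⟩]
  · have : {v ∈ s | f v = f p} = {p} := by
      ext v
      refine ⟨fun hv => ?_, fun hv => ?_⟩
      · by_contra hne
        exact (h3 v hv.1 hne).ne hv.2
      · rw [Set.mem_singleton_iff.1 hv]
        exact ⟨hp, rfl⟩
    rw [this, convexHull_singleton]
  · by_cases hvp : v = p
    · rw [hvp]
    · exact (h3 v hv hvp).le

/-- In a generating set of least cardinality no point lies in the hull of the others, so Hahn–Banach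
exposes each of them. -/
lemma IsPolytope.exposedPoints {P : Set W} (h : IsPolytope P) :
    (P.exposedPoints ℝ).Finite ∧ convexHull ℝ (P.exposedPoints ℝ) = P := by
  classical
  obtain ⟨s, hf, hn, hP⟩ := h
  obtain ⟨t, ht, hmin⟩ := WellFounded.has_min (measure Finset.card).wf
    {t : Finset W | convexHull ℝ (t : Set W) = P} ⟨hf.toFinset, by simp [hP]⟩
  have hPn : P.Nonempty := hP ▸ hn.convexHull
  have htn : (t : Set W).Nonempty := by
    rw [← ht] at hPn
    exact convexHull_nonempty_iff.1 hPn
  have heq : P.exposedPoints ℝ = t := by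
    apply Set.Subset.antisymm
    · rw [← show convexHull ℝ (t : Set W) = P from ht]
      exact exposedPoints_convexHull_subset t.finite_toSet htn
    · intro p hp
      rw [← show convexHull ℝ (t : Set W) = P from ht]
      refine mem_exposedPoints_of_notMem t.finite_toSet hp fun hmem => ?_
      refine hmin (t.erase p) ?_ (Finset.card_erase_lt_of_mem hp)
      refine Set.Subset.antisymm ?_ ?_
      · rw [← show convexHull ℝ (t : Set W) = P from ht]
        exact convexHull_mono (by simp)
      · rw [← show convexHull ℝ (t : Set W) = P from ht]
        refine convexHull_min (fun q hq => ?_) (convex_convexHull ℝ _)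
        by_cases hqp : q = p
        · rw [hqp, Finset.coe_erase]; exact hmem
        · exact subset_convexHull ℝ _ (by simpa [hqp] using hq)
  rw [heq]
  exact ⟨t.finite_toSet, ht⟩

lemma IsPolytope.finite {P : Set W} (h : IsPolytope P) : (P.exposedPoints ℝ).Finite :=
  h.exposedPoints.1

lemma IsPolytope.hull {P : Set W} (h : IsPolytope P) : convexHull ℝ (P.exposedPoints ℝ) = P :=
  h.exposedPoints.2

lemma IsPolytope.exposedPoints_nonempty {P : Set W} (h : IsPolytope P) :
    (P.exposedPoints ℝ).Nonempty := by
  have := h.nonempty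
  rw [← h.hull] at this
  exact convexHull_nonempty_iff.1 this

lemma IsPolytope.exposedPoints_maxFace_subset {P : Set W} (h : IsPolytope P)
    (c : StrongDual ℝ W) : (maxFace P c).exposedPoints ℝ ⊆ P.exposedPoints ℝ := by
  obtain ⟨v, hv, hmax⟩ := exists_max_of_finite h.finite h.exposedPoints_nonempty c
  have := maxFace_convexHull (a := c v) hmax ⟨v, hv, rfl⟩
  rw [h.hull] at this
  rw [this]
  have hn : {w ∈ P.exposedPoints ℝ | c w = c v}.Nonempty := ⟨v, hv, rfl⟩
  exact (exposedPoints_convexHull_subset (h.finite.subset fun x hx => hx.1) hn).trans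
    fun x hx => hx.1

lemma exposedPoints_of_subset {P F : Set W} {v : W} (hv : v ∈ P.exposedPoints ℝ) (hF : F ⊆ P)
    (hvF : v ∈ F) : v ∈ F.exposedPoints ℝ := by
  obtain ⟨-, c, hc⟩ := hv
  exact ⟨hvF, c, fun y hy => hc y (hF hy)⟩

lemma IsPolytope.le_of_vertices {P : Set W} (h : IsPolytope P) {c : StrongDual ℝ W} {a : ℝ}
    (hv : ∀ v ∈ P.exposedPoints ℝ, c v ≤ a) {x : W} (hx : x ∈ P) : c x ≤ a := by
  rw [← h.hull] at hx
  exact convexHull_min (t := {y | c y ≤ a}) hv (convex_halfSpace_le c.isLinear a) hx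

lemma IsPolytope.subset_of_vertices {P A : Set W} (h : IsPolytope P) (hA : Convex ℝ A)
    (hv : P.exposedPoints ℝ ⊆ A) : P ⊆ A := by
  rw [← h.hull]
  exact convexHull_min hv hA

/-- Only finitely many vertices lie off the face, and each stays strictly below a fixed point of the
face under small perturbations of `c`. -/
lemma IsPolytope.eventually_maxFace_subset {P : Set W} (h : IsPolytope P) (c : StrongDual ℝ W) :
    ∀ᶠ c' in 𝓝 c, maxFace P c' ⊆ maxFace P c := by
  obtain ⟨z, hz⟩ := (h.face c).nonempty
  have key : ∀ᶠ c' : StrongDual ℝ W in 𝓝 c, ∀ v ∈ P.exposedPoints ℝ,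
      v ∉ maxFace P c → c' v < c' z := by
    refine (eventually_all_finite h.finite).2 fun v hv => ?_
    by_cases hvF : v ∈ maxFace P c
    · exact Eventually.of_forall fun _ hn => absurd hvF hn
    · have hlt : c v < c z := by
        by_contra hge
        exact hvF ⟨hv.1, fun y hy => (hz.2 y hy).trans (not_lt.1 hge)⟩
      have h1 : Continuous fun c' : StrongDual ℝ W => c' v := by fun_prop
      have h2 : Continuous fun c' : StrongDual ℝ W => c' z := by fun_prop
      filter_upwards [h1.continuousAt.eventually_lt h2.continuousAt hlt] with c' hc' _
      exact hc'
  filter_upwards [key] with c' hc'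
  refine (h.face c').subset_of_vertices (h.face c).convex fun v hv => ?_
  by_contra hn
  exact (hc' v (h.exposedPoints_maxFace_subset c' hv) hn).not_ge (hv.1.2 z hz.1)

lemma maxFace_of_const {F : Set W} {c : StrongDual ℝ W} (hc : ∀ x ∈ F, ∀ y ∈ F, c x = c y) :
    maxFace F c = F :=
  Set.Subset.antisymm (maxFace_subset F c) fun x hx => ⟨hx, fun y hy => (hc y hy x hx).le⟩

lemma maxFace_const {P : Set W} {c : StrongDual ℝ W} {x y : W} (hx : x ∈ maxFace P c)
    (hy : y ∈ maxFace P c) : c x = c y :=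
  le_antisymm (hy.2 x hx.1) (hx.2 y hy.1)

lemma IsPolytope.maxFace_eq_of_subset_of_const {P : Set W} (h : IsPolytope P)
    {c c' : StrongDual ℝ W}
    (hs : maxFace P c' ⊆ maxFace P c)
    (hc : ∀ x ∈ maxFace P c, ∀ y ∈ maxFace P c,
      c' x = c' y) :
    maxFace P c' = maxFace P c := by
  rw [maxFace_eq_of_subset (maxFace_subset P c) (h.face c').nonempty hs, maxFace_of_const hc]

lemma tendsto_add_smul (c g : StrongDual ℝ W) :
    Tendsto (fun ε : ℝ => c + ε • g) (𝓝[>] 0) (𝓝 c) := by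
  have : Continuous fun ε : ℝ => c + ε • g := by fun_prop
  have h := this.tendsto 0
  simp only [zero_smul, add_zero] at h
  exact h.mono_left nhdsWithin_le_nhds

lemma maxFace_add_smul_of_const {F : Set W} {c g : StrongDual ℝ W} {ε : ℝ} (hε : 0 < ε)
    (hc : ∀ x ∈ F, ∀ y ∈ F, c x = c y) : maxFace F (c + ε • g) = maxFace F g := by
  ext x
  refine and_congr_right fun hx => forall₂_congr fun y hy => ?_
  simp only [add_apply, smul_apply, smul_eq_mul,
    hc y hy x hx]
  rw [add_le_add_iff_left, mul_le_mul_iff_right₀ hε]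

/-- Lexicographic optimization: a small multiple of `g` only breaks the ties left by `c`. Hence
faces of faces are faces. -/
lemma IsPolytope.eventually_maxFace_maxFace {P : Set W} (h : IsPolytope P)
    (c g : StrongDual ℝ W) : ∀ᶠ ε : ℝ in 𝓝[>] 0,
      maxFace P (c + ε • g) =
        maxFace (maxFace P c) g := by
  filter_upwards [(tendsto_add_smul c g).eventually (h.eventually_maxFace_subset c),
    self_mem_nhdsWithin] with ε hε hpos
  rw [maxFace_eq_of_subset (maxFace_subset P c) (h.face _).nonempty hε,
    maxFace_add_smul_of_const hpos fun x hx y hy => maxFace_const hx hy]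

lemma IsPolytope.exists_maxFace_maxFace {P : Set W} (h : IsPolytope P) (c g : StrongDual ℝ W) :
    ∃ c', maxFace P c' =
        maxFace (maxFace P c) g :=
  let ⟨_, hε⟩ := (h.eventually_maxFace_maxFace c g).exists
  ⟨_, hε⟩

/-! ### Minkowski sums -/

lemma IsPolytope.add {P Q : Set W} (hP : IsPolytope P) (hQ : IsPolytope Q) :
    IsPolytope (P + Q) := by
  obtain ⟨s, hs, hsn, rfl⟩ := hP
  obtain ⟨t, ht, htn, rfl⟩ := hQ
  exact ⟨s + t, hs.add ht, hsn.add htn, (convexHull_add s t).symm⟩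

lemma IsPolytope.smul {P : Set W} (hP : IsPolytope P) (a : ℝ) : IsPolytope (a • P) := by
  obtain ⟨s, hs, hsn, rfl⟩ := hP
  exact ⟨a • s, hs.smul_set, hsn.smul_set, (convexHull_smul a s).symm⟩

lemma IsPolytope.sum {ι : Type*} (s : Finset ι) {P : ι → Set W} (hP : ∀ i ∈ s, IsPolytope (P i)) :
    IsPolytope (∑ i ∈ s, P i) := by
  classical
  induction s using Finset.induction_on with
  | empty => exact Finset.sum_empty (f := P) ▸ IsPolytope.singleton (0 : W)
  | insert i s hi ih =>
    rw [Finset.sum_insert hi]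
    exact (hP i (by simp)).add (ih fun j hj => hP j (by simp [hj]))

lemma maxFace_add {P Q : Set W} {c : StrongDual ℝ W} (hP : (maxFace P c).Nonempty)
    (hQ : (maxFace Q c).Nonempty) : maxFace (P + Q) c = maxFace P c + maxFace Q c := by
  obtain ⟨p, hp⟩ := hP
  obtain ⟨q, hq⟩ := hQ
  ext z
  constructor
  · rintro ⟨⟨x, hx, y, hy, rfl⟩, hmax⟩
    have := hmax (p + q) (Set.add_mem_add hp.1 hq.1)
    simp only [map_add] at this
    have h1 := hp.2 x hx
    have h2 := hq.2 y hy
    exact Set.add_mem_add ⟨hx, fun w hw => (hp.2 w hw).trans (by linarith)⟩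
      ⟨hy, fun w hw => (hq.2 w hw).trans (by linarith)⟩
  · rintro ⟨x, hx, y, hy, rfl⟩
    refine ⟨Set.add_mem_add hx.1 hy.1, ?_⟩
    rintro _ ⟨x', hx', y', hy', rfl⟩
    simp only [map_add]
    exact add_le_add (hx.2 x' hx') (hy.2 y' hy')

lemma IsPolytope.maxFace_add {P Q : Set W} (hP : IsPolytope P) (hQ : IsPolytope Q)
    (c : StrongDual ℝ W) : maxFace (P + Q) c =
      maxFace P c + maxFace Q c :=
  PolytopeDeformation.maxFace_add (hP.face c).nonempty (hQ.face c).nonempty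

/-- Decompositions of the vertices of a Minkowski sum are unique. -/
lemma add_unique_of_exposed {P Q : Set W} {p : W} (hp : p ∈ (P + Q).exposedPoints ℝ) {u u' x x' : W}
    (hu : u ∈ P) (hx : x ∈ Q) (hu' : u' ∈ P) (hx' : x' ∈ Q) (h : u + x = p) (h' : u' + x' = p) :
    u = u' ∧ x = x' := by
  obtain ⟨-, c, hc⟩ := hp
  have h1 := hc (u + x') (Set.add_mem_add hu hx')
  have h2 := hc (u' + x) (Set.add_mem_add hu' hx)
  have e1 : c u + c x = c p := by rw [← map_add, h]
  have e2 : c u' + c x' = c p := by rw [← map_add, h']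
  rw [map_add] at h1 h2
  have h3 := h1.2 (by linarith)
  have : x' = x := by rw [← h] at h3; exact add_left_cancel h3
  subst this
  exact ⟨add_right_cancel (h.trans h'.symm), rfl⟩

omit [NormedSpace ℝ W] in
lemma singleton_of_add_eq_singleton {A B : Set W} (hA : A.Nonempty) (hB : B.Nonempty) {p : W}
    (h : A + B = {p}) : ∃ a b, A = {a} ∧ B = {b} ∧ a + b = p := by
  obtain ⟨a, ha⟩ := hA
  obtain ⟨b, hb⟩ := hB
  have key : ∀ x ∈ A, ∀ y ∈ B, x + y = p := fun x hx y hy => by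
    have : x + y ∈ ({p} : Set W) := h ▸ Set.add_mem_add hx hy
    exact this
  refine ⟨a, b, Set.eq_singleton_iff_unique_mem.2 ⟨ha, fun x hx => ?_⟩,
    Set.eq_singleton_iff_unique_mem.2 ⟨hb, fun y hy => ?_⟩, key a ha b hb⟩
  · exact add_right_cancel ((key x hx b hb).trans (key a ha b hb).symm)
  · exact add_left_cancel ((key a ha y hy).trans (key a ha b hb).symm)

/-! ### Edges -/

/-- The segment from `u` to `v` is an edge of `P`. -/
def IsEdge (P : Set W) (u v : W) : Prop :=
  u ≠ v ∧ ∃ c, maxFace P c = segment ℝ u v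

lemma IsEdge.symm {P : Set W} {u v : W} (h : IsEdge P u v) : IsEdge P v u :=
  ⟨h.1.symm, by rw [segment_symm]; exact h.2⟩

lemma left_mem_exposedPoints_segment {u v : W} : u ∈ (segment ℝ u v).exposedPoints ℝ := by
  rcases eq_or_ne u v with rfl | h
  · rw [segment_same]
    exact mem_exposedPoints_iff.2 ⟨0, maxFace_singleton _ _⟩
  · obtain ⟨f, hf⟩ := geometric_hahn_banach_point_point (E := W) h.symm
    refine ⟨left_mem_segment ℝ u v, f, ?_⟩
    rintro _ ⟨a, b, ha, hb, hab, rfl⟩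
    have ha' : a = 1 - b := by linarith
    subst ha'
    simp only [map_add, map_smul, smul_eq_mul]
    constructor
    · nlinarith
    · intro h1
      have : b * (f u - f v) ≤ 0 := by nlinarith
      have hb0 : b = 0 := le_antisymm (by by_contra hb'; nlinarith) hb
      simp [hb0]

lemma IsEdge.left_mem {P : Set W} (hP : IsPolytope P) {u v : W} (h : IsEdge P u v) :
    u ∈ P.exposedPoints ℝ := by
  obtain ⟨-, c, hc⟩ := h
  exact hP.exposedPoints_maxFace_subset c (hc ▸ left_mem_exposedPoints_segment)

lemma IsEdge.right_mem {P : Set W} (hP : IsPolytope P) {u v : W} (h : IsEdge P u v) :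
    v ∈ P.exposedPoints ℝ := h.symm.left_mem hP

lemma IsPolytope.isEdge_of_maxFace {P : Set W} (h : IsPolytope P) {c : StrongDual ℝ W} {u v : W}
    (he : IsEdge (maxFace P c) u v) : IsEdge P u v := by
  obtain ⟨hne, g, hg⟩ := he
  obtain ⟨c', hc'⟩ := h.exists_maxFace_maxFace c g
  exact ⟨hne, c', hc'.trans hg⟩

lemma maxFace_of_subset {P F : Set W} {c : StrongDual ℝ W} {E : Set W} (hF : F ⊆ P)
    (hE : maxFace P c = E) (hne : E.Nonempty) (hEF : E ⊆ F) : maxFace F c = E := by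
  rw [← hE]
  rw [← hE] at hne hEF
  exact (maxFace_eq_of_subset hF hne hEF).symm

lemma segment_nonempty (u v : W) : (segment ℝ u v).Nonempty := ⟨u, left_mem_segment ℝ u v⟩

lemma eq_or_eq_of_mem_exposedPoints_segment {u v w : W} {P : Set W} (hw : w ∈ P.exposedPoints ℝ)
    (hs : segment ℝ u v ⊆ P) (hwm : w ∈ segment ℝ u v) : w = u ∨ w = v := by
  have := exposedPoints_of_subset hw hs hwm
  rw [← convexHull_pair] at this
  simpa using exposedPoints_convexHull_subset (by simp) (by simp) this

lemma IsPolytope.eq_segment_of_vertices {P : Set W} (h : IsPolytope P) {u v : W}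
    (hV : P.exposedPoints ℝ = {u, v}) : P = segment ℝ u v := by
  rw [← h.hull, hV, convexHull_pair]

/-! ### The vertex figure -/

/-- The direction from `u` to `w`, normalized by a functional `c` maximal at `u`. -/
noncomputable def figDir (c : StrongDual ℝ W) (u w : W) : W := (c u - c w)⁻¹ • (w - u)

/-- The vertex figure of `P` at a vertex `u` exposed by `c`, placed in the hyperplane `c = -1`. -/
def vertexFigure (P : Set W) (c : StrongDual ℝ W) (u : W) : Set W :=
  convexHull ℝ (figDir c u '' (P.exposedPoints ℝ \ {u}))

lemma lt_of_maxFace_eq_singleton {P : Set W} {c : StrongDual ℝ W} {u w : W}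
    (hc : maxFace P c = {u}) (hw : w ∈ P) (hne : w ≠ u) : c w < c u := by
  have hu : u ∈ maxFace P c := hc ▸ rfl
  by_contra hge
  have : w ∈ maxFace P c := ⟨hw, fun y hy => (hu.2 y hy).trans (not_lt.1 hge)⟩
  rw [hc] at this
  exact hne this

section
variable {P : Set W} {c : StrongDual ℝ W} {u : W}

lemma apply_figDir {w : W} (hw : c w < c u) : c (figDir c u w) = -1 := by
  have h : c u - c w ≠ 0 := (sub_pos.2 hw).ne'
  simp only [figDir, map_smul, map_sub, smul_eq_mul]
  field_simp
  ring

lemma smul_figDir {w : W} (hw : c w < c u) : (c u - c w) • figDir c u w = w - u := by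
  have h : c u - c w ≠ 0 := (sub_pos.2 hw).ne'
  rw [figDir, smul_smul, mul_inv_cancel₀ h, one_smul]

lemma mul_apply_figDir {w : W} (hw : c w < c u) (g : StrongDual ℝ W) :
    (c u - c w) * g (figDir c u w) = g w - g u := by
  rw [← smul_eq_mul, ← map_smul, smul_figDir hw, map_sub]

lemma apply_figDir_pos {w : W} (hw : c w < c u) {g : StrongDual ℝ W} :
    0 < g (figDir c u w) ↔ g u < g w := by
  rw [← sub_pos (b := g u), ← mul_apply_figDir hw, mul_pos_iff_of_pos_left (sub_pos.2 hw)]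

lemma IsPolytope.isPolytope_vertexFigure (hP : IsPolytope P) (hV : (P.exposedPoints ℝ \ {u}).Nonempty) :
    IsPolytope (vertexFigure P c u) :=
  ⟨_, (hP.finite.subset Set.sdiff_subset).image _, hV.image _, rfl⟩

lemma figDir_mem {w : W} (hw : w ∈ P.exposedPoints ℝ) (hne : w ≠ u) :
    figDir c u w ∈ vertexFigure P c u :=
  subset_convexHull ℝ _ ⟨w, ⟨hw, hne⟩, rfl⟩

lemma IsPolytope.exists_maxFace_of_vertexFigure (hP : IsPolytope P) (hc : maxFace P c = {u})
    (hV : (P.exposedPoints ℝ \ {u}).Nonempty) (g : StrongDual ℝ W) :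
    ∃ g', maxFace P g' = convexHull ℝ {w ∈ P.exposedPoints ℝ |
      w = u ∨ figDir c u w ∈ maxFace (vertexFigure P c u) g} := by
  have hD := hP.isPolytope_vertexFigure (c := c) hV
  obtain ⟨z, hz⟩ := (hD.face g).nonempty
  have hu : u ∈ P.exposedPoints ℝ := mem_exposedPoints_iff.2 ⟨c, hc⟩
  have hlt : ∀ w ∈ P.exposedPoints ℝ, w ≠ u → c w < c u := fun w hw hne =>
    lt_of_maxFace_eq_singleton hc hw.1 hne
  have hval : ∀ w ∈ P.exposedPoints ℝ, w ≠ u →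
      (g + g z • c) w = (g + g z • c) u + (c u - c w) * (g (figDir c u w) - g z) := by
    intro w hw hne
    have := mul_apply_figDir (hlt w hw hne) g
    simp only [add_apply, smul_apply, smul_eq_mul]
    linarith
  -- Since `c = -1` on the figure, `g + g z • c` equals `g - g z` there: nonpositive, and zero
  -- exactly on the face of `g`.
  refine ⟨g + g z • c, ?_⟩
  have := maxFace_convexHull (s := P.exposedPoints ℝ) (c := g + g z • c) (a := (g + g z • c) u)
    (fun w hw => ?_) ⟨u, hu, rfl⟩
  · rw [hP.hull] at this
    rw [this]
    congr 1
    ext w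
    refine and_congr_right fun hw => ?_
    by_cases hne : w = u
    · simp [hne]
    · rw [hval w hw hne, add_eq_left, mul_eq_zero, or_iff_right (sub_pos.2 (hlt w hw hne)).ne',
        or_iff_right hne, sub_eq_zero]
      refine ⟨fun h => ⟨figDir_mem hw hne, fun y hy => (hz.2 y hy).trans h.ge⟩, fun h => ?_⟩
      exact maxFace_const h hz
  · by_cases hne : w = u
    · rw [hne]
    · rw [hval w hw hne, add_le_iff_nonpos_right]
      exact mul_nonpos_of_nonneg_of_nonpos (sub_pos.2 (hlt w hw hne)).le
        (sub_nonpos.2 (hz.2 _ (figDir_mem hw hne)))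

/-- Two vertices in the same direction lie on one ray from `u`; the nearer one is in the segment
from `u` to the other, hence is one of its endpoints. -/
lemma IsPolytope.figDir_injOn (hP : IsPolytope P) (hc : maxFace P c = {u}) :
    Set.InjOn (figDir c u) (P.exposedPoints ℝ \ {u}) := by
  have hu : u ∈ P := (hc ▸ rfl : u ∈ maxFace P c).1
  have key : ∀ w ∈ P.exposedPoints ℝ \ {u}, ∀ w' ∈ P.exposedPoints ℝ \ {u},
      figDir c u w = figDir c u w' → c w ≤ c w' → w = w' := by
    intro w hw w' hw' h hle
    have h1 := lt_of_maxFace_eq_singleton hc hw.1.1 hw.2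
    have h2 := lt_of_maxFace_eq_singleton hc hw'.1.1 hw'.2
    have hmem : w' ∈ segment ℝ u w := by
      rw [segment_eq_image']
      refine ⟨(c u - c w') / (c u - c w), ⟨div_nonneg (by linarith) (by linarith), ?_⟩, ?_⟩
      · exact (div_le_one (by linarith)).2 (by linarith)
      · change u + _ = w'
        rw [← smul_figDir h1, smul_smul, div_mul_cancel₀ _ (sub_pos.2 h1).ne', h, smul_figDir h2]
        abel
    rcases eq_or_eq_of_mem_exposedPoints_segment hw'.1 (hP.convex.segment_subset hu hw.1.1) hmem
      with h | h
    · exact absurd h hw'.2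
    · exact h.symm
  intro w hw w' hw' h
  rcases le_total (c w) (c w') with hle | hle
  · exact key w hw w' hw' h hle
  · exact (key w' hw' w hw h.symm hle).symm

/-- The vertices of the vertex figure come from the edges at `u`. -/
lemma IsPolytope.exists_isEdge_of_vertexFigure (hP : IsPolytope P) (hc : maxFace P c = {u})
    (hV : (P.exposedPoints ℝ \ {u}).Nonempty) {d : W}
    (hd : d ∈ (vertexFigure P c u).exposedPoints ℝ) :
    ∃ w, IsEdge P u w ∧ figDir c u w = d := by
  have hu : u ∈ P.exposedPoints ℝ := mem_exposedPoints_iff.2 ⟨c, hc⟩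
  obtain ⟨w, hw, rfl⟩ := exposedPoints_convexHull_subset
    ((hP.finite.subset Set.sdiff_subset).image _) (hV.image _) hd
  obtain ⟨g, hg⟩ := mem_exposedPoints_iff.1 hd
  obtain ⟨g', hg'⟩ := hP.exists_maxFace_of_vertexFigure hc hV g
  refine ⟨w, ⟨fun h => hw.2 h.symm, g', ?_⟩, rfl⟩
  rw [hg', ← convexHull_pair, hg]
  congr 1
  ext v
  constructor
  · rintro ⟨hv, rfl | h⟩
    · exact .inl rfl
    · by_cases hvu : v = u
      · exact .inl hvu
      · exact .inr (hP.figDir_injOn hc ⟨hv, hvu⟩ hw h)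
  · rintro (rfl | rfl)
    · exact ⟨hu, .inl rfl⟩
    · exact ⟨hw.1, .inr rfl⟩

end

/-- A vertex not maximizing a linear functional has a neighbour where it is larger. -/
lemma IsPolytope.exists_improving_edge {P : Set W} (hP : IsPolytope P) {u : W}
    (hu : u ∈ P.exposedPoints ℝ) {c : StrongDual ℝ W} (h : u ∉ maxFace P c) :
    ∃ w, IsEdge P u w ∧ c u < c w := by
  obtain ⟨c₀, hc₀⟩ := mem_exposedPoints_iff.1 hu
  have : ∃ v ∈ P.exposedPoints ℝ, c u < c v := by
    by_contra! hcon
    exact h ⟨hu.1, fun y hy => hP.le_of_vertices hcon hy⟩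
  obtain ⟨v, hv, hlt⟩ := this
  have hvu : v ≠ u := by rintro rfl; exact hlt.ne rfl
  have hV : (P.exposedPoints ℝ \ {u}).Nonempty := ⟨v, hv, hvu⟩
  have hpos : 0 < c (figDir c₀ u v) :=
    (apply_figDir_pos (lt_of_maxFace_eq_singleton hc₀ hv.1 hvu)).2 hlt
  -- A functional positive somewhere on the figure is positive at one of its vertices, and these are
  -- edge directions.
  have : ∃ d ∈ (vertexFigure P c₀ u).exposedPoints ℝ, 0 < c d := by
    by_contra! hcon
    exact hpos.not_ge ((hP.isPolytope_vertexFigure hV).le_of_vertices hcon (figDir_mem hv hvu))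
  obtain ⟨d, hd, hd0⟩ := this
  obtain ⟨w, hw, rfl⟩ := hP.exists_isEdge_of_vertexFigure hc₀ hV hd
  exact ⟨w, hw, (apply_figDir_pos
    (lt_of_maxFace_eq_singleton hc₀ (hw.right_mem hP).1 hw.1.symm)).1 hd0⟩

/-- The part of the graph of a polytope in an open half-space is connected: a function that is
constant along its edges is constant on its vertices. -/
lemma IsPolytope.eq_of_const_on_edges {P : Set W} (hP : IsPolytope P) {X : Type*} {f : W → X}
    {c : StrongDual ℝ W} {a : ℝ}
    (hf : ∀ u v, IsEdge P u v → a < c u → a < c v → f u = f v) {u v : W}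
    (hu : u ∈ P.exposedPoints ℝ) (hv : v ∈ P.exposedPoints ℝ) (hau : a < c u) (hav : a < c v) :
    f u = f v := by
  obtain ⟨z, hz⟩ := (hP.face c).exposedPoints_nonempty
  have hzP := hP.exposedPoints_maxFace_subset c hz
  obtain ⟨c₀, hc₀⟩ := mem_exposedPoints_iff.1 hz
  -- Tie-breaking by `c₀` makes `z` the unique maximum. For small `ε` it keeps all strict
  -- inequalities of `c` between vertices, so an improving edge never lowers `c` and stays in the
  -- half-space.
  have hmono : ∀ᶠ ε : ℝ in 𝓝[>] 0, ∀ p ∈ P.exposedPoints ℝ, ∀ q ∈ P.exposedPoints ℝ,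
      c p < c q → (c + ε • c₀) p < (c + ε • c₀) q := by
    refine (eventually_all_finite hP.finite).2 fun p hp =>
      (eventually_all_finite hP.finite).2 fun q hq => ?_
    by_cases hpq : c p < c q
    · have h1 : Continuous fun c' : StrongDual ℝ W => c' p := by fun_prop
      have h2 : Continuous fun c' : StrongDual ℝ W => c' q := by fun_prop
      filter_upwards [(tendsto_add_smul c c₀).eventually
        (h1.continuousAt.eventually_lt h2.continuousAt hpq)] with ε hε _
      exact hε
    · exact Eventually.of_forall fun _ h => absurd h hpq
  obtain ⟨ε, hε, hface⟩ := (hmono.and (hP.eventually_maxFace_maxFace c c₀)).exists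
  rw [hc₀] at hface
  have key : ∀ p ∈ P.exposedPoints ℝ, a < c p → f p = f z := by
    by_contra! hcon
    obtain ⟨p₀, hp₀, hap₀, hne₀⟩ := hcon
    have hfin : {p ∈ P.exposedPoints ℝ | a < c p ∧ f p ≠ f z}.Finite :=
      hP.finite.subset fun p hp => hp.1
    obtain ⟨p, ⟨hp, hap, hne⟩, hmax⟩ := exists_max_of_finite hfin ⟨p₀, hp₀, hap₀, hne₀⟩ (c + ε • c₀)
    have hpz : p ≠ z := by rintro rfl; exact hne rfl
    obtain ⟨q, hpq, hlt⟩ := hP.exists_improving_edge hp (c := c + ε • c₀)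
      (by rw [hface]; exact hpz)
    have hq := hpq.right_mem hP
    have haq : a < c q := by
      refine hap.trans_le ?_
      by_contra! hqp
      exact (hε q hq p hp hqp).not_ge hlt.le
    have hqz : f q = f z := by
      by_contra hne'
      exact (hmax q ⟨hq, haq, hne'⟩).not_gt hlt
    exact hne ((hf p q hpq hap haq).trans hqz)
  rw [key u hu hau, key v hv hav]

/-- The edges of the vertex figure come from the 2-faces at `u`. -/
lemma IsPolytope.exists_isTwoFace_of_vertexFigure {P : Set W} {c : StrongDual ℝ W} {u : W}
    (hP : IsPolytope P) (hc : maxFace P c = {u}) {w w' : W}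
    (hw : IsEdge P u w) (hw' : IsEdge P u w')
    (hd : IsEdge (vertexFigure P c u) (figDir c u w) (figDir c u w')) :
    ∃ g, Module.finrank ℝ (vectorSpan ℝ (maxFace P g)) = 2 ∧ u ∈ maxFace P g ∧ w ∈ maxFace P g ∧
      w' ∈ maxFace P g ∧ ∀ v ∈ (maxFace P g).exposedPoints ℝ,
        v = u ∨ figDir c u v ∈ segment ℝ (figDir c u w) (figDir c u w') := by
  have hu : u ∈ P.exposedPoints ℝ := mem_exposedPoints_iff.2 ⟨c, hc⟩
  have hwP := hw.right_mem hP
  have hwP' := hw'.right_mem hP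
  obtain ⟨hne, g, hg⟩ := hd
  obtain ⟨g', hg'⟩ := hP.exists_maxFace_of_vertexFigure hc ⟨w, hwP, hw.1.symm⟩ g
  rw [hg] at hg'
  set T := {v ∈ P.exposedPoints ℝ | v = u ∨ figDir c u v ∈ segment ℝ (figDir c u w) (figDir c u w')}
    with hT
  have huT : u ∈ T := ⟨hu, .inl rfl⟩
  have hwT : w ∈ T := ⟨hwP, .inr (left_mem_segment ℝ _ _)⟩
  have hwT' : w' ∈ T := ⟨hwP', .inr (right_mem_segment ℝ _ _)⟩
  have hlt : ∀ v ∈ P.exposedPoints ℝ, v ≠ u → c v < c u := fun v hv hne =>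
    lt_of_maxFace_eq_singleton hc hv.1 hne
  have hlw := hlt w hwP hw.1.symm
  have hlw' := hlt w' hwP' hw'.1.symm
  refine ⟨g', ?_, ?_, ?_, ?_, fun v hv => ?_⟩
  · have hspan : vectorSpan ℝ (maxFace P g') =
        Submodule.span ℝ (Set.range ![figDir c u w, figDir c u w']) := by
      rw [hg', ← direction_affineSpan, affineSpan_convexHull, direction_affineSpan,
        vectorSpan_eq_span_vsub_set_right ℝ huT, Matrix.range_cons, Matrix.range_cons,
        Matrix.range_empty, Set.union_empty, ← Set.insert_eq]
      apply le_antisymm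
      · rw [Submodule.span_le]
        rintro _ ⟨v, ⟨hv, hvu⟩, rfl⟩
        by_cases h : v = u
        · simp [h]
        · have hseg := hvu.resolve_left h
          change v - u ∈ _
          rw [← smul_figDir (hlt v hv h)]
          refine Submodule.smul_mem _ _ ?_
          obtain ⟨α, β, -, -, -, hab⟩ := hseg
          exact Submodule.mem_span_pair.2 ⟨α, β, hab⟩
      · rw [Submodule.span_le]
        rintro _ (rfl | rfl)
        · exact Submodule.smul_mem _ _ (Submodule.subset_span ⟨w, hwT, rfl⟩)
        · exact Submodule.smul_mem _ _ (Submodule.subset_span ⟨w', hwT', rfl⟩)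
    -- As `c = -1` on both directions, a linear relation must be a multiple of their difference,
    -- which is nonzero.
    have hli : LinearIndependent ℝ ![figDir c u w, figDir c u w'] := by
      rw [LinearIndependent.pair_iff]
      intro s t hst
      have h1 := congrArg c hst
      rw [map_add, map_smul, map_smul, apply_figDir hlw, apply_figDir hlw', map_zero, smul_eq_mul,
        smul_eq_mul] at h1
      have ht : t = -s := by linarith
      subst ht
      rw [neg_smul, ← sub_eq_add_neg, ← smul_sub, smul_eq_zero, sub_eq_zero] at hst
      have hs := hst.resolve_right hne
      simp [hs]
    rw [hspan, finrank_span_eq_card hli, Fintype.card_fin]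
  · exact hg' ▸ subset_convexHull ℝ _ huT
  · exact hg' ▸ subset_convexHull ℝ _ hwT
  · exact hg' ▸ subset_convexHull ℝ _ hwT'
  · rw [hg'] at hv
    exact (exposedPoints_convexHull_subset (hP.finite.subset fun x hx => hx.1) ⟨u, huT⟩ hv).2

/-! ### Generic functionals -/

/-- In `W ⧸ Z`, some linear form is nonzero at finitely many given nonzero vectors. -/
lemma exists_functional_vanishing_on [FiniteDimensional ℝ W] (Z : Submodule ℝ W) {T : Set W}
    (hT : T.Finite) :
    ∃ b : StrongDual ℝ W, (∀ z ∈ Z, b z = 0) ∧ ∀ t ∈ T, t ∉ Z → b t ≠ 0 := by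
  have : Finite {t // t ∈ T ∧ t ∉ Z} := (hT.subset fun x (hx : x ∈ T ∧ x ∉ Z) => hx.1).to_subtype
  obtain ⟨f, hf⟩ := Module.exists_dual_forall_apply_ne_zero (K := ℝ)
    (fun t : {t // t ∈ T ∧ t ∉ Z} => Z.mkQ t) (fun t h => t.2.2 (by simpa using h))
  refine ⟨LinearMap.toContinuousLinearMap (f ∘ₗ Z.mkQ), fun z hz => ?_, fun t ht htZ =>
    hf ⟨t, ht, htZ⟩⟩
  have : Z.mkQ z = 0 := by simpa using hz
  simp [this]

/-- Adding a small multiple of a generic functional vanishing on `Z` removes the unwanted zeros of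
`c` on `T` and creates none. -/
lemma exists_generic_near [FiniteDimensional ℝ W] {c : StrongDual ℝ W} {Z : Submodule ℝ W}
    (hc : ∀ z ∈ Z, c z = 0) {T : Set W} (hT : T.Finite) {p : StrongDual ℝ W → Prop}
    (hp : ∀ᶠ c' in 𝓝 c, p c') :
    ∃ c', p c' ∧ (∀ z ∈ Z, c' z = 0) ∧ ∀ t ∈ T, t ∉ Z → c' t ≠ 0 := by
  obtain ⟨b, hb, hbT⟩ := exists_functional_vanishing_on Z hT
  have key : ∀ᶠ ε : ℝ in 𝓝[>] 0, ∀ t ∈ T, t ∉ Z → (c + ε • b) t ≠ 0 := by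
    refine (eventually_all_finite hT).2 fun t ht => ?_
    by_cases htZ : t ∈ Z
    · exact Eventually.of_forall fun _ h => absurd htZ h
    · by_cases hct : c t = 0
      · filter_upwards [self_mem_nhdsWithin] with ε hε _
        simpa [hct] using ⟨(show (0 : ℝ) < ε from hε).ne', hbT t ht htZ⟩
      · have h1 : Continuous fun c' : StrongDual ℝ W => c' t := by fun_prop
        filter_upwards [(tendsto_add_smul c b).eventually (h1.continuousAt.eventually_ne hct)]
          with ε hε _
        exact hε
  obtain ⟨ε, hε, hpε⟩ := (key.and ((tendsto_add_smul c b).eventually hp)).exists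
  exact ⟨c + ε • b, hpε, fun z hz => by simp [hc z hz, hb z hz], hε⟩

/-! ### Closing conditions on 2-faces -/

/-- Edge jumps which come from a potential on each 2-face come from a potential. -/
lemma IsPolytope.exists_potential [FiniteDimensional ℝ W] {P : Set W} (hP : IsPolytope P)
    {κ : W → W → W} (hsymm : ∀ u v, IsEdge P u v → κ v u = -κ u v)
    (h2 : ∀ g, Module.finrank ℝ (vectorSpan ℝ (maxFace P g)) = 2 → ∃ ψ : W → W, ∀ u v,
      IsEdge P u v → u ∈ maxFace P g → v ∈ maxFace P g → ψ v - ψ u = κ u v) :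
    ∃ ψ : W → W, ∀ u v, IsEdge P u v → ψ v - ψ u = κ u v := by
  classical
  obtain ⟨c, -, hc⟩ := exists_functional_vanishing_on (⊥ : Submodule ℝ W)
    (T := P.exposedPoints ℝ - P.exposedPoints ℝ) (hP.finite.sub hP.finite)
  have hinj : ∀ u ∈ P.exposedPoints ℝ, ∀ v ∈ P.exposedPoints ℝ, u ≠ v → c u ≠ c v := by
    intro u hu v hv hne heq
    refine hc (u - v) (Set.sub_mem_sub hu hv) (by simpa [sub_eq_zero] using hne) ?_
    rw [map_sub, heq, sub_self]
  -- The potential is built on upper sets for the injective height `c`, adding vertices in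
  -- decreasing order.
  suffices H : ∀ s : Finset W, (s : Set W) ⊆ P.exposedPoints ℝ →
      (∀ v ∈ s, ∀ w ∈ P.exposedPoints ℝ, c v < c w → w ∈ s) →
      ∃ ψ : W → W, ∀ u ∈ s, ∀ v ∈ s, IsEdge P u v → ψ v - ψ u = κ u v by
    obtain ⟨ψ, hψ⟩ := H hP.finite.toFinset (by simp) (by simp +contextual)
    exact ⟨ψ, fun u v he =>
      hψ u (by simpa using he.left_mem hP) v (by simpa using he.right_mem hP) he⟩
  intro s
  induction s using Finset.induction_on_min_value c with
  | empty => exact fun _ _ => ⟨0, by simp⟩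
  | insert u s hus hmin ih =>
    intro hsP hup
    rw [Finset.coe_insert, Set.insert_subset_iff] at hsP
    obtain ⟨huP, hsP⟩ := hsP
    have hlt : ∀ w ∈ s, c u < c w := fun w hw =>
      lt_of_le_of_ne (hmin w hw) (hinj u huP w (hsP hw) (by rintro rfl; exact hus hw))
    have hmem : ∀ w ∈ P.exposedPoints ℝ, c u < c w → w ∈ s := by
      intro w hw h
      rcases Finset.mem_insert.1 (hup u (by simp) w hw h) with rfl | h'
      · exact absurd h (lt_irrefl _)
      · exact h'
    obtain ⟨ψ, hψ⟩ := ih hsP fun v hv w hw hvw => hmem w hw ((hlt v hv).trans hvw)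
    -- All higher neighbours of `u` must prescribe the same value at `u`.
    have hdiff : ∀ w ∈ s, ∀ w' ∈ s, IsEdge P u w → IsEdge P u w' →
        ψ w - κ u w = ψ w' - κ u w' := by
      intro w hw w' hw' hew hew'
      obtain ⟨c₀, hc₀⟩ := mem_exposedPoints_iff.1 huP
      have hV : (P.exposedPoints ℝ \ {u}).Nonempty := ⟨w, hsP hw, hew.1.symm⟩
      have hc₀lt : ∀ v ∈ P.exposedPoints ℝ, v ≠ u → c₀ v < c₀ u := fun v hv hne =>
        lt_of_maxFace_eq_singleton hc₀ hv.1 hne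
      have hpos : ∀ v ∈ P.exposedPoints ℝ, v ≠ u → (0 < c (figDir c₀ u v) ↔ c u < c v) :=
        fun v hv hne => apply_figDir_pos (hc₀lt v hv hne)
      -- The prescribed value, carried to the vertex figure by injectivity of `figDir`; the higher
      -- vertices become the points with `c > 0`.
      obtain ⟨F, hF⟩ : ∃ F : W → W, ∀ v ∈ P.exposedPoints ℝ \ {u},
          F (figDir c₀ u v) = ψ v - κ u v :=
        ⟨fun d => ψ (Function.invFunOn (figDir c₀ u) (P.exposedPoints ℝ \ {u}) d) -
          κ u (Function.invFunOn (figDir c₀ u) (P.exposedPoints ℝ \ {u}) d), fun v hv => by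
            simp only [(hP.figDir_injOn hc₀).leftInvOn_invFunOn hv]⟩
      have hD := hP.isPolytope_vertexFigure (c := c₀) hV
      have hvert : ∀ w, IsEdge P u w →
          figDir c₀ u w ∈ (vertexFigure P c₀ u).exposedPoints ℝ := by
        rintro w ⟨hne, g, hg⟩
        have hwP : w ∈ P.exposedPoints ℝ := IsEdge.right_mem hP ⟨hne, g, hg⟩
        refine mem_exposedPoints_of_notMem
          ((hP.finite.subset Set.sdiff_subset).image _) ⟨w, ⟨hwP, hne.symm⟩, rfl⟩ fun hmem => ?_
        have hu : u ∈ maxFace P g := hg ▸ left_mem_segment ℝ u w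
        have hw : w ∈ maxFace P g := hg ▸ right_mem_segment ℝ u w
        -- The functional exposing the edge is negative on all other directions and zero on that of
        -- `w`.
        have hsub : convexHull ℝ (figDir c₀ u '' (P.exposedPoints ℝ \ {u}) \ {figDir c₀ u w}) ⊆
            {d | g d < 0} := by
          refine convexHull_min ?_ (convex_halfSpace_lt g.isLinear 0)
          rintro _ ⟨⟨v, hv, rfl⟩, hvw⟩
          have hvF : v ∉ maxFace P g := by
            rw [hg]
            intro hvs
            rcases eq_or_eq_of_mem_exposedPoints_segment hv.1
              (hP.convex.segment_subset huP.1 hwP.1) hvs with h | h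
            · exact hv.2 h
            · exact hvw (by rw [h]; rfl)
          have hgv : g v < g u := by
            by_contra! hge
            exact hvF ⟨hv.1.1, fun y hy => (hu.2 y hy).trans hge⟩
          have h1 := mul_apply_figDir (hc₀lt v hv.1 hv.2) g
          have h2 := sub_pos.2 (hc₀lt v hv.1 hv.2)
          by_contra hcon
          have := mul_nonneg h2.le (not_lt.1 hcon)
          linarith
        have h0 : g (figDir c₀ u w) < 0 := hsub hmem
        have h1 := mul_apply_figDir (hc₀lt w hwP hne.symm) g
        rw [maxFace_const hw hu, sub_self] at h1
        exact h0.ne ((mul_eq_zero.1 h1).resolve_left (sub_pos.2 (hc₀lt w hwP hne.symm)).ne')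
      have hconst := hD.eq_of_const_on_edges (f := F) (c := c) (a := 0) ?_ (hvert w hew)
        (hvert w' hew') ((hpos w (hsP hw) hew.1.symm).2 (hlt w hw))
        ((hpos w' (hsP hw') hew'.1.symm).2 (hlt w' hw'))
      · rwa [hF w ⟨hsP hw, hew.1.symm⟩, hF w' ⟨hsP hw', hew'.1.symm⟩] at hconst
      · clear hw hw' hew hew' w w'
        intro d d' hdd hd0 hd0'
        obtain ⟨w, hew, rfl⟩ := hP.exists_isEdge_of_vertexFigure hc₀ hV (hdd.left_mem hD)
        obtain ⟨w', hew', rfl⟩ := hP.exists_isEdge_of_vertexFigure hc₀ hV (hdd.right_mem hD)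
        have hwP := hew.right_mem hP
        have hwP' := hew'.right_mem hP
        have hcw := (hpos w hwP hew.1.symm).1 hd0
        have hcw' := (hpos w' hwP' hew'.1.symm).1 hd0'
        rw [hF w ⟨hwP, hew.1.symm⟩, hF w' ⟨hwP', hew'.1.symm⟩]
        obtain ⟨g, hdim, hug, hwg, hwg', hverts⟩ :=
          hP.exists_isTwoFace_of_vertexFigure hc₀ hew hew' hdd
        obtain ⟨ψF, hψF⟩ := h2 g hdim
        -- The other vertices of the 2-face have directions between two upward ones, so `u` is its
        -- lowest vertex. Then `ψ` is already defined on the rest, and differs from the potential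
        -- `ψF` by a constant along that connected part.
        have hlow : ∀ v ∈ (maxFace P g).exposedPoints ℝ, v ≠ u → c u < c v := by
          intro v hv hne
          refine (hpos v (hP.exposedPoints_maxFace_subset g hv) hne).1 ?_
          have := (convex_halfSpace_gt c.isLinear 0).segment_subset hd0 hd0'
          exact this ((hverts v hv).resolve_left hne)
        have hexp : ∀ v ∈ P.exposedPoints ℝ, v ∈ maxFace P g →
            v ∈ (maxFace P g).exposedPoints ℝ := fun v hv hvg =>
          exposedPoints_of_subset hv (maxFace_subset P g) hvg
        have := (hP.face g).eq_of_const_on_edges (f := fun v => ψ v - ψF v) (c := c) (a := c u)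
          (fun p q hpq hp hq => ?_) (hexp w hwP hwg) (hexp w' hwP' hwg') hcw hcw'
        · have e1 := hψF u w hew hug hwg
          have e2 := hψF u w' hew' hug hwg'
          rw [← e1, ← e2]
          have : ψ w - (ψF w - ψF u) - (ψ w' - (ψF w' - ψF u)) =
            (ψ w - ψF w) - (ψ w' - ψF w') := by abel
          rw [← sub_eq_zero, this, sub_eq_zero]
          assumption
        · have hpq' := hP.isEdge_of_maxFace hpq
          have e1 := hψF p q hpq' (hpq.left_mem (hP.face g)).1 (hpq.right_mem (hP.face g)).1
          have e2 := hψ p (hmem p (hpq'.left_mem hP) hp) q (hmem q (hpq'.right_mem hP) hq) hpq'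
          have : ψ p - ψF p - (ψ q - ψF q) = (ψF q - ψF p) - (ψ q - ψ p) := by abel
          rw [← sub_eq_zero]
          simp only [this, e1, e2, sub_self]
    have hκ : ∃ z : W, ∀ w ∈ s, IsEdge P u w → ψ w - κ u w = z := by
      by_cases hex : ∃ w ∈ s, IsEdge P u w
      · obtain ⟨w, hw, hew⟩ := hex
        exact ⟨ψ w - κ u w, fun w' hw' hew' => hdiff w' hw' w hw hew' hew⟩
      · push Not at hex
        -- Without a higher neighbour the value at `u` is arbitrary.
        exact ⟨0, fun w hw hew => absurd hew (hex w hw)⟩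
    obtain ⟨z, hz⟩ := hκ
    have hne : ∀ v ∈ s, v ≠ u := fun v hv h => hus (h ▸ hv)
    refine ⟨Function.update ψ u z, fun p hp q hq hpq => ?_⟩
    rcases Finset.mem_insert.1 hp with rfl | hp'
    · rcases Finset.mem_insert.1 hq with rfl | hq'
      · exact absurd rfl hpq.1
      · rw [Function.update_self, Function.update_of_ne (hne q hq'), ← hz q hq' hpq]
        abel
    · rcases Finset.mem_insert.1 hq with rfl | hq'
      · rw [Function.update_self, Function.update_of_ne (hne p hp'), ← hz p hp' hpq.symm,
          hsymm p q hpq]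
        abel
      · rw [Function.update_of_ne (hne q hq'), Function.update_of_ne (hne p hp'), hψ p hp' q hq' hpq]

/-! ### Deformations of a sum in parallelogramic position -/

/-- The framework deformations, as total functions, in terms of edges given by their endpoints. -/
def IsDefo (P : Set W) (ψ : W → W) : Prop :=
  ∀ u v, IsEdge P u v → ∃ l : ℝ, 0 ≤ l ∧ ψ v - ψ u = l • (v - u)

/-- Parallelogramic position, in terms of edges given by their endpoints. -/
structure Transverse (P Q : Set W) : Prop where
  left : ∀ u v, IsEdge P u v → IsTwoGeneric Q (v - u)
  right : ∀ x y, IsEdge Q x y → IsTwoGeneric P (y - x)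
  notParallel : ∀ u v, IsEdge P u v → ∀ x y, IsEdge Q x y → y - x ∉ Submodule.span ℝ {v - u}

lemma Transverse.symm {P Q : Set W} (h : Transverse P Q) : Transverse Q P where
  left := h.right
  right := h.left
  notParallel x y hxy u v huv hmem := by
    obtain ⟨t, ht⟩ := Submodule.mem_span_singleton.1 hmem
    have ht0 : t ≠ 0 := by
      rintro rfl
      rw [zero_smul] at ht
      exact huv.1 (sub_eq_zero.1 ht.symm).symm
    refine h.notParallel u v huv x y hxy (Submodule.mem_span_singleton.2 ⟨t⁻¹, ?_⟩)
    rw [← ht, smul_smul, inv_mul_cancel₀ ht0, one_smul]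

lemma IsPolytope.eq_singleton_of_no_edge {P : Set W} (hP : IsPolytope P)
    (h : ∀ u v, ¬ IsEdge P u v) : ∃ v, P = {v} := by
  obtain ⟨v, hv⟩ := hP.exposedPoints_nonempty
  refine ⟨v, ?_⟩
  have : P.exposedPoints ℝ = {v} := by
    refine Set.eq_singleton_iff_unique_mem.2 ⟨hv, fun w hw => ?_⟩
    by_contra hne
    obtain ⟨c, hc⟩ := mem_exposedPoints_iff.1 hw
    obtain ⟨z, hz, -⟩ := hP.exists_improving_edge hv (c := c) (by rw [hc]; exact fun h => hne h.symm)
    exact h v z hz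
  rw [← hP.hull, this, convexHull_singleton]

lemma exists_common_maxFace_maxFace {P Q : Set W} (hP : IsPolytope P) (hQ : IsPolytope Q)
    (c g : StrongDual ℝ W) :
    ∃ c', maxFace P c' = maxFace (maxFace P c) g ∧ maxFace Q c' = maxFace (maxFace Q c) g :=
  let ⟨_, hε⟩ := ((hP.eventually_maxFace_maxFace c g).and
    (hQ.eventually_maxFace_maxFace c g)).exists
  ⟨_, hε⟩

lemma maxFace_segment {x y : W} {g : StrongDual ℝ W} (h : g x < g y) :
    maxFace (segment ℝ x y) g = {y} := by
  rw [← convexHull_pair, maxFace_convexHull (a := g y) (by simp [h.le]) ⟨y, by simp, rfl⟩]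
  have : {v ∈ ({x, y} : Set W) | g v = g y} = {y} := by
    ext v
    constructor
    · rintro ⟨rfl | rfl, hv⟩
      · exact absurd hv h.ne
      · rfl
    · rintro rfl
      exact ⟨.inr rfl, rfl⟩
  rw [this, convexHull_singleton]

lemma segment_add_singleton (u v x : W) :
    segment ℝ u v + {x} = segment ℝ (u + x) (v + x) := by
  rw [← convexHull_pair, ← convexHull_pair, ← convexHull_singleton (𝕜 := ℝ) x, ← convexHull_add]
  simp [Set.image_pair]

lemma maxFace_add_eq_segment {P Q : Set W} {u v x : W} {c : StrongDual ℝ W}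
    (hu : maxFace P c = segment ℝ u v) (hx : maxFace Q c = {x}) :
    maxFace (P + Q) c = segment ℝ (u + x) (v + x) := by
  rw [maxFace_add (hu ▸ segment_nonempty u v) (hx ▸ Set.singleton_nonempty x), hu, hx,
    segment_add_singleton]

lemma isEdge_add_right {P Q : Set W} {u v x : W} {c : StrongDual ℝ W} (hne : u ≠ v)
    (hu : maxFace P c = segment ℝ u v) (hx : maxFace Q c = {x}) :
    IsEdge (P + Q) (u + x) (v + x) :=
  ⟨fun h => hne (add_right_cancel h), c, maxFace_add_eq_segment hu hx⟩

lemma const_on_segment {u v : W} {g : StrongDual ℝ W} (h : g (v - u) = 0) :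
    ∀ x ∈ segment ℝ u v, ∀ y ∈ segment ℝ u v, g x = g y := by
  have key : ∀ x ∈ segment ℝ u v, g x = g u := by
    intro x hx
    rw [map_sub, sub_eq_zero] at h
    obtain ⟨a, b, -, -, hab, rfl⟩ := hx
    rw [map_add, map_smul, map_smul, h, ← add_smul, hab, one_smul]
  intro x hx y hy
  rw [key x hx, key y hy]

lemma exists_functional_pos [FiniteDimensional ℝ W] {e a : W} (h : a ∉ Submodule.span ℝ {e}) :
    ∃ g : StrongDual ℝ W, g e = 0 ∧ 0 < g a := by
  obtain ⟨b, hb, hba⟩ := exists_functional_vanishing_on (Submodule.span ℝ {e})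
    (Set.finite_singleton a)
  have h0 := hb e (Submodule.mem_span_singleton_self e)
  rcases lt_or_gt_of_ne (hba a rfl h) with hlt | hgt
  · exact ⟨-b, by simp [h0], by simpa using hlt⟩
  · exact ⟨b, h0, hgt⟩

/-- Perturb `c` by a functional that vanishes on `v - u` and is positive on `y - x`. -/
lemma exists_separated_endpoint [FiniteDimensional ℝ W] {P Q : Set W} (hP : IsPolytope P)
    (hQ : IsPolytope Q) {u v x y : W} {c : StrongDual ℝ W} (hu : maxFace P c = segment ℝ u v)
    (hx : maxFace Q c = segment ℝ x y) (hpar : y - x ∉ Submodule.span ℝ {v - u}) :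
    ∃ c', maxFace P c' = segment ℝ u v ∧ maxFace Q c' = {y} := by
  obtain ⟨g, hg0, hg⟩ := exists_functional_pos hpar
  obtain ⟨c', h1, h2⟩ := exists_common_maxFace_maxFace hP hQ c g
  refine ⟨c', ?_, ?_⟩
  · rw [h1, hu, maxFace_of_const (const_on_segment hg0)]
  · rw [h2, hx, maxFace_segment (by rwa [map_sub, sub_pos] at hg)]

/-- Opposite edges of a parallelogram are deformed in the same way. -/
lemma jump_eq_of_parallelogram [FiniteDimensional ℝ W] {P Q : Set W} (hP : IsPolytope P)
    (hQ : IsPolytope Q) {ψ : W → W} (hψ : IsDefo (P + Q) ψ) {u v x y : W} {c : StrongDual ℝ W}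
    (huv : u ≠ v) (hxy : x ≠ y) (hu : maxFace P c = segment ℝ u v)
    (hx : maxFace Q c = segment ℝ x y)
    (hpar : y - x ∉ Submodule.span ℝ {v - u}) (hpar' : v - u ∉ Submodule.span ℝ {y - x}) :
    ψ (v + x) - ψ (u + x) = ψ (v + y) - ψ (u + y) := by
  obtain ⟨c₁, hc₁, hc₁'⟩ := exists_separated_endpoint hP hQ hu hx hpar
  obtain ⟨c₂, hc₂, hc₂'⟩ := exists_separated_endpoint hP hQ hu (segment_symm ℝ x y ▸ hx)
    (by rwa [← neg_sub y x, Submodule.neg_mem_iff])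
  obtain ⟨c₃, hc₃, hc₃'⟩ := exists_separated_endpoint hQ hP hx hu hpar'
  obtain ⟨c₄, hc₄, hc₄'⟩ := exists_separated_endpoint hQ hP hx (segment_symm ℝ u v ▸ hu)
    (by rwa [← neg_sub v u, Submodule.neg_mem_iff])
  obtain ⟨l₁, -, h₁⟩ := hψ _ _ (isEdge_add_right huv hc₁ hc₁')
  obtain ⟨l₂, -, h₂⟩ := hψ _ _ (isEdge_add_right huv hc₂ hc₂')
  obtain ⟨l₃, -, h₃⟩ := hψ _ _ (add_comm Q P ▸ isEdge_add_right hxy hc₃ hc₃')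
  obtain ⟨l₄, -, h₄⟩ := hψ _ _ (add_comm Q P ▸ isEdge_add_right hxy hc₄ hc₄')
  rw [add_sub_add_right_eq_sub] at h₁ h₂ h₃ h₄
  rw [add_comm y v, add_comm x v] at h₃
  rw [add_comm y u, add_comm x u] at h₄
  -- The jumps around the parallelogram sum to zero; since its sides are not parallel, both
  -- coefficients vanish.
  have key : (l₃ - l₄) • (y - x) = (l₁ - l₂) • (v - u) := by
    rw [sub_smul, sub_smul, ← h₁, ← h₂, ← h₃, ← h₄]
    abel
  have h34 : l₃ - l₄ = 0 := by
    by_contra hne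
    refine hpar (Submodule.mem_span_singleton.2 ⟨(l₃ - l₄)⁻¹ * (l₁ - l₂), ?_⟩)
    rw [mul_smul, ← key, smul_smul, inv_mul_cancel₀ hne, one_smul]
  rw [h34, zero_smul, eq_comm, smul_eq_zero, sub_eq_zero, sub_eq_zero] at key
  rw [h₁, h₂, key.resolve_right huv.symm]

/-- Any point of `P` off `F` is strictly worse for both functionals, hence for their convex
combinations. -/
lemma maxFace_combination {P F : Set W} {c c' : StrongDual ℝ W} (h : maxFace P c = F)
    (h' : maxFace P c' = F) (hF : F.Nonempty) {s t : ℝ} (hs : 0 ≤ s) (ht : 0 ≤ t)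
    (hst : s + t = 1) : maxFace P (s • c + t • c') = F := by
  obtain ⟨z, hz⟩ := hF
  have hz1 : z ∈ maxFace P c := h ▸ hz
  have hz2 : z ∈ maxFace P c' := h' ▸ hz
  ext w
  constructor
  · intro hw
    by_contra hwF
    have h1 : c w < c z := by
      by_contra hge
      exact hwF (h ▸ ⟨hw.1, fun y hy => (hz1.2 y hy).trans (not_lt.1 hge)⟩)
    have h2 : c' w < c' z := by
      by_contra hge
      exact hwF (h' ▸ ⟨hw.1, fun y hy => (hz2.2 y hy).trans (not_lt.1 hge)⟩)
    have := hw.2 z hz1.1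
    simp only [add_apply, smul_apply, smul_eq_mul] at this
    have e1 := mul_le_mul_of_nonneg_left h1.le hs
    have e2 := mul_le_mul_of_nonneg_left h2.le ht
    rcases hs.eq_or_lt with rfl | hs
    · have : t = 1 := by linarith
      subst this
      linarith
    · have := mul_lt_mul_of_pos_left h1 hs
      linarith
  · intro hw
    have hw1 : w ∈ maxFace P c := h ▸ hw
    have hw2 : w ∈ maxFace P c' := h' ▸ hw
    refine ⟨hw1.1, fun y hy => ?_⟩
    simp only [add_apply, smul_apply, smul_eq_mul]
    exact add_le_add (mul_le_mul_of_nonneg_left (hw1.2 y hy) hs)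
      (mul_le_mul_of_nonneg_left (hw2.2 y hy) ht)

/-- If `e` is 2-generic with respect to `Q`, a face of `Q` is a vertex, an edge, or has three vertices
whose differences are linearly independent together with `e`. -/
lemma maxFace_eq_singleton_or_segment_or {Q : Set W} (hQ : IsPolytope Q) {e : W}
    (he : IsTwoGeneric Q e)
    (hpar : ∀ x y, IsEdge Q x y → y - x ∉ Submodule.span ℝ {e}) (hpar' : ∀ x y, IsEdge Q x y →
      e ∉ Submodule.span ℝ {y - x}) (c : StrongDual ℝ W) :
    (∃ x, maxFace Q c = {x}) ∨ (∃ x y, x ≠ y ∧ maxFace Q c = segment ℝ x y) ∨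
      ∃ x ∈ maxFace Q c ∩ Q.exposedPoints ℝ, ∃ y ∈ maxFace Q c ∩ Q.exposedPoints ℝ,
      ∃ z ∈ maxFace Q c ∩ Q.exposedPoints ℝ, y - x ∉ Submodule.span ℝ {e} ∧
        z - x ∉ Submodule.span ℝ {e, y - x} := by
  have hF := hQ.face c
  have hFV := hQ.exposedPoints_maxFace_subset c
  by_cases hE : ∃ x y, IsEdge (maxFace Q c) x y
  · obtain ⟨x, y, hxy⟩ := hE
    have hxF := hxy.left_mem hF
    have hyF := hxy.right_mem hF
    have hxyQ := hQ.isEdge_of_maxFace hxy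
    right
    by_cases hz : ∃ z ∈ (maxFace Q c).exposedPoints ℝ, z - x ∉ Submodule.span ℝ {e, y - x}
    · obtain ⟨z, hz, hzs⟩ := hz
      exact .inr ⟨x, ⟨hxF.1, hFV hxF⟩, y, ⟨hyF.1, hFV hyF⟩, z, ⟨hz.1, hFV hz⟩, hpar x y hxyQ, hzs⟩
    push Not at hz
    -- All vertices now lie in `x + span {e, y - x}`. One outside the edge has a nonzero
    -- `e`-coefficient, so the face would be a 2-face parallel to `e`, against 2-genericity.
    refine .inl ⟨x, y, hxy.1, hF.eq_segment_of_vertices ?_⟩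
    refine Set.Subset.antisymm (fun z hzF => ?_) ?_
    · by_contra hzn
      obtain ⟨-, g, hg⟩ := hxy
      have hxg : x ∈ maxFace (maxFace Q c) g := hg ▸ left_mem_segment ℝ x y
      have hyg : y ∈ maxFace (maxFace Q c) g := hg ▸ right_mem_segment ℝ x y
      obtain ⟨α, β, hαβ⟩ := Submodule.mem_span_pair.1 (hz z hzF)
      -- If `α = 0`, then `z` is on the line of the edge, so `g` puts it in the edge and it is an
      -- endpoint.
      have hα : α ≠ 0 := by
        rintro rfl
        rw [zero_smul, zero_add] at hαβ
        have hgz : g z = g x := by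
          rw [← sub_eq_zero, ← map_sub, ← hαβ, map_smul, map_sub, maxFace_const hyg hxg]
          simp
        have : z ∈ maxFace (maxFace Q c) g := ⟨hzF.1, fun w hw => (hxg.2 w hw).trans hgz.ge⟩
        rw [hg] at this
        exact hzn (eq_or_eq_of_mem_exposedPoints_segment hzF
          (hF.convex.segment_subset hxF.1 hyF.1) this)
      have hyv : y - x ∈ vectorSpan ℝ (maxFace Q c) := vsub_mem_vectorSpan ℝ hyF.1 hxF.1
      have hev : e ∈ vectorSpan ℝ (maxFace Q c) := by
        have hzv : z - x ∈ vectorSpan ℝ (maxFace Q c) := vsub_mem_vectorSpan ℝ hzF.1 hxF.1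
        have : e = α⁻¹ • ((z - x) - β • (y - x)) := by
          rw [← hαβ, add_sub_cancel_right, smul_smul, inv_mul_cancel₀ hα, one_smul]
        rw [this]
        exact Submodule.smul_mem _ _ (Submodule.sub_mem _ hzv (Submodule.smul_mem _ _ hyv))
      refine he (maxFace Q c) ⟨fun _ => ⟨c, rfl⟩, ?_⟩ hev
      have hspan : vectorSpan ℝ (maxFace Q c) = Submodule.span ℝ (Set.range ![e, y - x]) := by
        rw [Matrix.range_cons, Matrix.range_cons, Matrix.range_empty, Set.union_empty,
          ← Set.insert_eq]
        apply le_antisymm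
        · rw [← hF.hull, ← direction_affineSpan, affineSpan_convexHull, direction_affineSpan,
            vectorSpan_eq_span_vsub_set_right ℝ hxF, Submodule.span_le]
          rintro _ ⟨w, hw, rfl⟩
          exact hz w hw
        · rw [Submodule.span_le]
          rintro _ (rfl | rfl)
          exacts [hev, hyv]
      have hli : LinearIndependent ℝ ![e, y - x] := by
        rw [LinearIndependent.pair_iff]
        intro s t hst
        have hs : s = 0 := by
          by_contra hs
          refine hpar' x y hxyQ (Submodule.mem_span_singleton.2 ⟨-(s⁻¹ * t), ?_⟩)
          have : e = s⁻¹ • (s • e) := by rw [smul_smul, inv_mul_cancel₀ hs, one_smul]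
          rw [this, eq_neg_of_add_eq_zero_left hst, smul_neg, smul_smul, neg_smul]
        subst hs
        rw [zero_smul, zero_add, smul_eq_zero, sub_eq_zero] at hst
        exact ⟨rfl, hst.resolve_right hxyQ.1.symm⟩
      rw [hspan, finrank_span_eq_card hli, Fintype.card_fin]
    · rintro _ (rfl | rfl)
      exacts [hxF, hyF]
  · push Not at hE
    exact .inl (hF.eq_singleton_of_no_edge hE)

/-- The parallel edges `e + x` of `P + Q`, for an edge `e` of `P`, are deformed in the same way. -/
lemma Transverse.jump_eq [FiniteDimensional ℝ W] {P Q : Set W} (hPQ : Transverse P Q)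
    (hP : IsPolytope P) (hQ : IsPolytope Q) {ψ : W → W} (hψ : IsDefo (P + Q) ψ) {u v x y : W}
    (huv : u ≠ v) {c₀ c₁ : StrongDual ℝ W}
    (hu₀ : maxFace P c₀ = segment ℝ u v) (hx : maxFace Q c₀ = {x})
    (hu₁ : maxFace P c₁ = segment ℝ u v) (hy : maxFace Q c₁ = {y}) :
    ψ (v + x) - ψ (u + x) = ψ (v + y) - ψ (u + y) := by
  have hedge : IsEdge P u v := ⟨huv, c₀, hu₀⟩
  set V := Q.exposedPoints ℝ with hV
  have hVV : (V - V).Finite := hQ.finite.sub hQ.finite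
  set Z := Submodule.span ℝ {v - u} with hZ
  -- Move the endpoint `c₁` to a generic `c₂` that still exposes `e` and `y`. If `a` and `b` vanish
  -- at one functional on the segment from `c₀`, other than `c₀`, then `c₂` kills `c₀ a • b - c₀ b •
  -- a`; these vectors are put in `T` to exclude this.
  obtain ⟨c₂, ⟨hs, hs'⟩, hc₂, hc₂T⟩ := exists_generic_near (c := c₁) (Z := Z)
    (T := (V - V) ∪ (Set.image2 (fun a b => c₀ a • b - c₀ b • a) (V - V) (V - V)))
    (p := fun c' => maxFace P c' ⊆ maxFace P c₁ ∧ maxFace Q c' ⊆ maxFace Q c₁)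
    (fun z hz => by
      obtain ⟨t, rfl⟩ := Submodule.mem_span_singleton.1 hz
      rw [map_smul, map_sub, maxFace_const (hu₁ ▸ right_mem_segment ℝ u v)
        (hu₁ ▸ left_mem_segment ℝ u v), sub_self, smul_zero])
    (hVV.union (hVV.image2 _ hVV))
    ((hP.eventually_maxFace_subset c₁).and (hQ.eventually_maxFace_subset c₁))
  have hu₂ : maxFace P c₂ = segment ℝ u v := by
    rw [← hu₁]
    refine hP.maxFace_eq_of_subset_of_const hs ?_
    rw [hu₁]
    exact const_on_segment (hc₂ _ (Submodule.mem_span_singleton_self _))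
  have hy₂ : maxFace Q c₂ = {y} := by
    rw [hy] at hs'
    exact (Set.subset_singleton_iff_eq.1 hs').resolve_left (hQ.face c₂).nonempty.ne_empty
  clear hs hs' hu₁ hy
  let γ : unitInterval → StrongDual ℝ W := fun t => (1 - (t : ℝ)) • c₀ + (t : ℝ) • c₂
  have hγ : Continuous γ := by fun_prop
  have hγP : ∀ t, maxFace P (γ t) = segment ℝ u v := fun t =>
    maxFace_combination hu₀ hu₂ (segment_nonempty u v) (sub_nonneg.2 t.2.2) t.2.1 (by ring)
  have hγQ : ∀ t, ∀ z ∈ maxFace Q (γ t) ∩ V, ∀ z' ∈ maxFace Q (γ t) ∩ V,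
      ψ (v + z) - ψ (u + z) = ψ (v + z') - ψ (u + z') := by
    intro t
    rcases maxFace_eq_singleton_or_segment_or hQ (hPQ.left u v hedge) (hPQ.notParallel u v hedge)
      (fun x y hxy => hPQ.symm.notParallel x y hxy u v hedge) (γ t) with
      ⟨z, hz⟩ | ⟨z, z', hne, hz⟩ | ⟨z, hz, z', hz', w, hw, ha, hb⟩
    · rw [hz]
      rintro _ ⟨rfl, -⟩ _ ⟨rfl, -⟩
      rfl
    · have hzz : IsEdge Q z z' := ⟨hne, γ t, hz⟩
      have := jump_eq_of_parallelogram hP hQ hψ huv hne (hγP t) hz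
        (hPQ.notParallel u v hedge z z' hzz) (hPQ.symm.notParallel z z' hzz u v hedge)
      have hseg : ∀ p ∈ maxFace Q (γ t) ∩ V, p = z ∨ p = z' := fun p hp =>
        eq_or_eq_of_mem_exposedPoints_segment hp.2 (hz ▸ maxFace_subset Q _) (hz ▸ hp.1)
      intro p hp q hq
      rcases hseg p hp with rfl | rfl <;> rcases hseg q hq with rfl | rfl
      exacts [rfl, this, this.symm, rfl]
    -- A larger face gives differences `a = z' - z` and `b = w - z`, independent modulo `e`, both
    -- killed by `γ t`. As `c₀` exposes a vertex, `t ≠ 0`, and the choice of `T` is contradicted.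
    · exfalso
      have haV : z' - z ∈ V - V := Set.sub_mem_sub hz'.2 hz.2
      have hbV : w - z ∈ V - V := Set.sub_mem_sub hw.2 hz.2
      have ha0 : γ t (z' - z) = 0 := by rw [map_sub, maxFace_const hz'.1 hz.1, sub_self]
      have hb0 : γ t (w - z) = 0 := by rw [map_sub, maxFace_const hw.1 hz.1, sub_self]
      have hc₂a := hc₂T _ (.inl haV) ha
      have hγt : ∀ p, γ t p = (1 - (t : ℝ)) * c₀ p + t * c₂ p := fun p => rfl
      have ht0 : (t : ℝ) ≠ 0 := by
        intro h
        have : γ t = c₀ := by simp [γ, h]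
        rw [this, hx] at hz hz'
        refine ha ?_
        rw [show z' = z from hz'.1.trans hz.1.symm, sub_self]
        exact Submodule.zero_mem _
      have hc₀a : c₀ (z' - z) ≠ 0 := by
        intro h
        rw [hγt, h, mul_zero, zero_add] at ha0
        exact (mul_ne_zero ht0 hc₂a) ha0
      refine hc₂T (c₀ (z' - z) • (w - z) - c₀ (w - z) • (z' - z))
        (.inr ⟨_, haV, _, hbV, rfl⟩) (fun hmem => hb ?_) ?_
      · obtain ⟨r, hr⟩ := Submodule.mem_span_singleton.1 hmem
        have : w - z = (c₀ (z' - z))⁻¹ • (r • (v - u) + c₀ (w - z) • (z' - z)) := by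
          rw [hr, sub_add_cancel, smul_smul, inv_mul_cancel₀ hc₀a, one_smul]
        rw [this]
        exact Submodule.smul_mem _ _ (Submodule.mem_span_pair.2 ⟨_, _, rfl⟩)
      · rw [hγt] at ha0 hb0
        have : (t : ℝ) * c₂ (c₀ (z' - z) • (w - z) - c₀ (w - z) • (z' - z)) = 0 := by
          rw [map_sub, map_smul, map_smul, smul_eq_mul, smul_eq_mul]
          linear_combination c₀ (z' - z) * hb0 - c₀ (w - z) * ha0
        exact (mul_eq_zero.1 this).resolve_left ht0
  have hvert : ∀ t, ∃ z, z ∈ maxFace Q (γ t) ∩ V := fun t =>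
    let ⟨z, hz⟩ := (hQ.face (γ t)).exposedPoints_nonempty
    ⟨z, hz.1, hQ.exposedPoints_maxFace_subset _ hz⟩
  choose ζ hζ using hvert
  -- Near `t` the faces of `Q` lie inside the face at `γ t`, on whose vertices the jumps agree.
  have hloc : IsLocallyConstant fun t => ψ (v + ζ t) - ψ (u + ζ t) := by
    rw [IsLocallyConstant.iff_eventually_eq]
    intro t
    filter_upwards [hγ.continuousAt.eventually (hQ.eventually_maxFace_subset (γ t))] with t' ht'
    exact hγQ t _ ⟨ht' (hζ t').1, (hζ t').2⟩ _ (hζ t)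
  have hends := hloc.apply_eq_of_preconnectedSpace 0 1
  have h0 : ζ 0 = x := by
    have := (hζ 0).1
    rwa [show γ 0 = c₀ by simp [γ], hx] at this
  have h1 : ζ 1 = y := by
    have := (hζ 1).1
    rwa [show γ 1 = c₂ by simp [γ], hy₂] at this
  simpa only [h0, h1] using hends

/-- Over a face of `P` which is in general position with respect to the edges of `Q`, there is a
vertex of `Q`. -/
lemma exists_maxFace_eq_singleton [FiniteDimensional ℝ W] {P Q : Set W} (hP : IsPolytope P)
    (hQ : IsPolytope Q) {c : StrongDual ℝ W}
    (h : ∀ x y, IsEdge Q x y → y - x ∉ vectorSpan ℝ (maxFace P c)) :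
    ∃ c' x, maxFace P c' = maxFace P c ∧ maxFace Q c' = {x} := by
  have hvan : ∀ g : StrongDual ℝ W, (∀ x ∈ maxFace P c, ∀ y ∈ maxFace P c, g x = g y) ↔
      ∀ z ∈ vectorSpan ℝ (maxFace P c), g z = 0 := by
    intro g
    constructor
    · intro hg z hz
      have : vectorSpan ℝ (maxFace P c) ≤ LinearMap.ker (g : W →ₗ[ℝ] ℝ) := by
        rw [vectorSpan, Submodule.span_le]
        rintro _ ⟨x, hx, y, hy, rfl⟩
        simp [hg x hx y hy]
      exact this hz
    · intro hg x hx y hy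
      rw [← sub_eq_zero, ← map_sub]
      exact hg _ (vsub_mem_vectorSpan ℝ hx hy)
  obtain ⟨c', hs, hc', hT⟩ := exists_generic_near (c := c)
    ((hvan c).1 fun x hx y hy => maxFace_const hx hy) (hQ.finite.sub hQ.finite)
    (hP.eventually_maxFace_subset c)
  have h1 := hP.maxFace_eq_of_subset_of_const hs ((hvan c').2 hc')
  obtain ⟨x, hx⟩ := (hQ.face c').eq_singleton_of_no_edge fun x y hxy => by
    have hxyQ := hQ.isEdge_of_maxFace hxy
    refine hT (y - x) (Set.sub_mem_sub (hxyQ.right_mem hQ) (hxyQ.left_mem hQ)) (h x y hxyQ) ?_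
    rw [map_sub, maxFace_const (hxy.right_mem (hQ.face c')).1 (hxy.left_mem (hQ.face c')).1,
      sub_self]
  exact ⟨c', x, h1, hx⟩

lemma vectorSpan_segment (u v : W) : vectorSpan ℝ (segment ℝ u v) = Submodule.span ℝ {v - u} := by
  rw [← convexHull_pair, ← direction_affineSpan, affineSpan_convexHull, direction_affineSpan,
    vectorSpan_pair_rev]
  rfl

lemma Transverse.exists_vertex_over_edge [FiniteDimensional ℝ W] {P Q : Set W}
    (hPQ : Transverse P Q) (hP : IsPolytope P) (hQ : IsPolytope Q) {u v : W} (h : IsEdge P u v) :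
    ∃ c x, maxFace P c = segment ℝ u v ∧ maxFace Q c = {x} := by
  obtain ⟨-, c, hc⟩ := id h
  obtain ⟨c', x, h1, h2⟩ := exists_maxFace_eq_singleton hP hQ (c := c) fun x y hxy => by
    rw [hc, vectorSpan_segment]
    exact hPQ.notParallel u v h x y hxy
  exact ⟨c', x, h1.trans hc, h2⟩

/-- A deformation of `P + Q` induces a deformation of `P`. -/
theorem Transverse.exists_isDefo_left [FiniteDimensional ℝ W] {P Q : Set W}
    (hPQ : Transverse P Q) (hP : IsPolytope P) (hQ : IsPolytope Q) {ψ : W → W}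
    (hψ : IsDefo (P + Q) ψ) :
    ∃ ψ' : W → W, IsDefo P ψ' ∧ ∀ u v x c, u ≠ v → maxFace P c = segment ℝ u v →
      maxFace Q c = {x} → ψ (v + x) - ψ (u + x) = ψ' v - ψ' u := by
  have hex : ∀ u v, IsEdge P u v → ∃ k : W, ∀ c x, maxFace P c = segment ℝ u v →
      maxFace Q c = {x} → ψ (v + x) - ψ (u + x) = k := by
    intro u v huv
    obtain ⟨c, x, hc, hx⟩ := hPQ.exists_vertex_over_edge hP hQ huv
    exact ⟨_, fun c' y hc' hy => hPQ.jump_eq hP hQ hψ huv.1 hc' hy hc hx⟩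
  choose! κ hκ using hex
  have hsymm : ∀ u v, IsEdge P u v → κ v u = -κ u v := by
    intro u v huv
    obtain ⟨c, x, hc, hx⟩ := hPQ.exists_vertex_over_edge hP hQ huv
    rw [← hκ u v huv c x hc hx, ← hκ v u huv.symm c x (segment_symm ℝ u v ▸ hc) hx, neg_sub]
  have h2 : ∀ g, Module.finrank ℝ (vectorSpan ℝ (maxFace P g)) = 2 → ∃ ψ : W → W, ∀ u v,
      IsEdge P u v → u ∈ maxFace P g → v ∈ maxFace P g → ψ v - ψ u = κ u v := by
    intro g hg
    obtain ⟨c, x, hc, hx⟩ := exists_maxFace_eq_singleton hP hQ (c := g) fun x y hxy =>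
      hPQ.right x y hxy _ ⟨fun _ => ⟨g, rfl⟩, hg⟩
    -- Over the 2-face lies a single vertex `x` of `Q`, so translating `ψ` by `x` gives the
    -- potential. Refining `c` inside the face exposes each of its edges without changing `x`.
    refine ⟨fun v => ψ (v + x), fun u v huv hu hv => ?_⟩
    obtain ⟨-, h, hh⟩ := id huv
    have hsub : segment ℝ u v ⊆ maxFace P c := by
      rw [hc]
      exact (hP.face g).convex.segment_subset hu hv
    obtain ⟨c', h1, h2⟩ := exists_common_maxFace_maxFace hP hQ c h
    refine hκ u v huv c' x ?_ ?_
    · rw [h1]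
      exact maxFace_of_subset (maxFace_subset P c) hh (segment_nonempty u v) hsub
    · rw [h2, hx, maxFace_singleton]
  obtain ⟨ψ', hψ'⟩ := hP.exists_potential hsymm h2
  refine ⟨ψ', fun u v huv => ?_, fun u v x c huv hc hx => ?_⟩
  · obtain ⟨c, x, hc, hx⟩ := hPQ.exists_vertex_over_edge hP hQ huv
    obtain ⟨l, hl, h⟩ := hψ _ _ (isEdge_add_right huv.1 hc hx)
    refine ⟨l, hl, ?_⟩
    rw [hψ' u v huv, ← hκ u v huv c x hc hx, h, add_sub_add_right_eq_sub]
  · rw [hψ' u v ⟨huv, c, hc⟩]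
    exact hκ u v ⟨huv, c, hc⟩ c x hc hx

/-! ### Edges as unordered pairs of vertices -/

lemma adj_iff {P : Set W} {u v : Vertex P} : (edgeGraph P).Adj u v ↔ IsEdge P (u : W) (v : W) := by
  constructor
  · rintro ⟨hne, hexp⟩
    obtain ⟨c, hc⟩ := hexp (segment_nonempty _ _)
    exact ⟨fun h => hne (Subtype.ext h), c, hc.symm⟩
  · rintro ⟨hne, c, hc⟩
    exact ⟨fun h => hne (congrArg _ h), fun _ => ⟨c, hc.symm⟩⟩

lemma Edge.exists_eq_mkEdge {P : Set W} (e : Edge P) :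
    ∃ (u v : Vertex P) (h : (edgeGraph P).Adj u v), e = mkEdge h := by
  obtain ⟨e, he⟩ := e
  induction e with
  | h u v => exact ⟨u, v, he, rfl⟩

lemma toSet_mkEdge {P : Set W} {u v : Vertex P} (h : (edgeGraph P).Adj u v) :
    (mkEdge h).toSet = segment ℝ (u : W) (v : W) := by
  rw [Edge.toSet, ← convexHull_pair]
  congr 1
  ext x
  simp [mkEdge]

lemma mkEdge_eq_iff {P : Set W} {u v u' v' : Vertex P} (h : (edgeGraph P).Adj u v)
    (h' : (edgeGraph P).Adj u' v') :
    mkEdge h = mkEdge h' ↔ (u = u' ∧ v = v') ∨ (u = v' ∧ v = u') := by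
  rw [Subtype.ext_iff]
  exact Sym2.eq_iff

lemma Edge.toSet_injective {P : Set W} (hP : IsPolytope P) :
    Function.Injective (Edge.toSet : Edge P → Set W) := by
  intro e e' h
  obtain ⟨u, v, huv, rfl⟩ := e.exists_eq_mkEdge
  obtain ⟨u', v', huv', rfl⟩ := e'.exists_eq_mkEdge
  rw [toSet_mkEdge, toSet_mkEdge] at h
  have hsub := hP.convex.segment_subset u'.2.1 v'.2.1
  have hu := eq_or_eq_of_mem_exposedPoints_segment u.2 hsub (h ▸ left_mem_segment ℝ _ _)
  have hv := eq_or_eq_of_mem_exposedPoints_segment v.2 hsub (h ▸ right_mem_segment ℝ _ _)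
  simp only [← Subtype.ext_iff] at hu hv
  rw [mkEdge_eq_iff]
  rcases hu with rfl | rfl <;> rcases hv with rfl | rfl
  · exact absurd rfl huv.1
  · exact .inl ⟨rfl, rfl⟩
  · exact .inr ⟨rfl, rfl⟩
  · exact absurd rfl huv.1

lemma ParallelogramicPosition.transverse {P Q : Set W} (hP : IsPolytope P) (hQ : IsPolytope Q)
    (h : ParallelogramicPosition P Q) : Transverse P Q where
  left u v huv := h.1 ⟨u, huv.left_mem hP⟩ ⟨v, huv.right_mem hP⟩ (adj_iff.2 huv)
  right x y hxy := h.2.1 ⟨x, hxy.left_mem hQ⟩ ⟨y, hxy.right_mem hQ⟩ (adj_iff.2 hxy)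
  notParallel u v huv x y hxy hmem := by
    obtain ⟨t, ht⟩ := Submodule.mem_span_singleton.1 hmem
    have ht0 : t ≠ 0 := by
      rintro rfl
      rw [zero_smul] at ht
      exact hxy.1 (sub_eq_zero.1 ht.symm).symm
    refine h.2.2 ⟨u, huv.left_mem hP⟩ ⟨v, huv.right_mem hP⟩ (adj_iff.2 huv)
      ⟨x, hxy.left_mem hQ⟩ ⟨y, hxy.right_mem hQ⟩ (adj_iff.2 hxy) ⟨t⁻¹, ?_⟩
    change v - u = t⁻¹ • (y - x)
    rw [← ht, smul_smul, inv_mul_cancel₀ ht0, one_smul]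

/-! ### Deformation cones in terms of total functions -/

/-- `lam` is the edge-deformation vector of `ψ`. -/
def HasEdgeVector (P : Set W) (ψ : W → W) (lam : Edge P → ℝ) : Prop :=
  ∀ (u v : Vertex P) (h : (edgeGraph P).Adj u v),
    lam (mkEdge h) • ((v : W) - u) = ψ v - ψ u

lemma IsDefo.exists_hasEdgeVector {P : Set W} {ψ : W → W} (hψ : IsDefo P ψ) :
    ∃ lam : Edge P → ℝ, (∀ e, 0 ≤ lam e) ∧ HasEdgeVector P ψ lam := by
  have : ∀ e : Edge P, ∃ l : ℝ, 0 ≤ l ∧ ∀ (u v : Vertex P) (h : (edgeGraph P).Adj u v),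
      e = mkEdge h → l • ((v : W) - u) = ψ v - ψ u := by
    intro e
    obtain ⟨u, v, h, rfl⟩ := e.exists_eq_mkEdge
    obtain ⟨l, hl, hlψ⟩ := hψ u v (adj_iff.1 h)
    refine ⟨l, hl, fun u' v' h' he => ?_⟩
    rcases (mkEdge_eq_iff h h').1 he with ⟨rfl, rfl⟩ | ⟨rfl, rfl⟩
    · exact hlψ.symm
    · rw [← neg_sub (v : W), smul_neg, ← hlψ, neg_sub]
  choose lam h0 hlam using this
  exact ⟨lam, h0, fun u v h => hlam _ u v h rfl⟩

lemma HasEdgeVector.unique {P : Set W} {ψ : W → W} {lam lam' : Edge P → ℝ}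
    (h : HasEdgeVector P ψ lam) (h' : HasEdgeVector P ψ lam') : lam = lam' := by
  funext e
  obtain ⟨u, v, huv, rfl⟩ := e.exists_eq_mkEdge
  refine smul_left_injective ℝ (sub_ne_zero.2 fun h => huv.1 (Subtype.ext h.symm)) ?_
  exact (h u v huv).trans (h' u v huv).symm

lemma HasEdgeVector.congr {P : Set W} {ψ ψ' : W → W} {lam : Edge P → ℝ}
    (h : HasEdgeVector P ψ lam) (hψ : ∀ v ∈ P.exposedPoints ℝ, ψ' v = ψ v) :
    HasEdgeVector P ψ' lam := fun u v huv => by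
  rw [hψ u u.2, hψ v v.2]
  exact h u v huv

lemma HasEdgeVector.isDefo {P : Set W} (hP : IsPolytope P) {ψ : W → W} {lam : Edge P → ℝ}
    (h : HasEdgeVector P ψ lam) (h0 : ∀ e, 0 ≤ lam e) : IsDefo P ψ := fun u v huv =>
  have hadj : (edgeGraph P).Adj ⟨u, huv.left_mem hP⟩ ⟨v, huv.right_mem hP⟩ := adj_iff.2 huv
  ⟨lam (mkEdge hadj), h0 _, (h _ _ hadj).symm⟩

lemma mem_defoCone_iff {P : Set W} (hP : IsPolytope P) {lam : Edge P → ℝ} :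
    lam ∈ defoCone P ↔ ∃ ψ : W → W, IsDefo P ψ ∧ HasEdgeVector P ψ lam := by
  classical
  constructor
  · rintro ⟨ψ, h0, hψ⟩
    have : HasEdgeVector P (fun v => if h : v ∈ P.exposedPoints ℝ then ψ ⟨v, h⟩ else 0) lam := by
      intro u v h
      simp only [u.2, v.2, dif_pos]
      exact hψ u v h
    exact ⟨_, this.isDefo hP h0, this⟩
  · rintro ⟨ψ, hψ, h⟩
    obtain ⟨lam', h0, h'⟩ := hψ.exists_hasEdgeVector
    obtain rfl := h.unique h'
    exact ⟨fun v => ψ v, h0, h⟩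

lemma isDefo_id (P : Set W) : IsDefo P id := fun _ _ _ => ⟨1, zero_le_one, (one_smul ℝ _).symm⟩

lemma one_mem_defoCone {P : Set W} (hP : IsPolytope P) : (1 : Edge P → ℝ) ∈ defoCone P :=
  (mem_defoCone_iff hP).2 ⟨id, isDefo_id P, fun _ _ _ => one_smul ℝ _⟩

/-! ### Edge classes -/

section EdgeClass

variable {P Q : Set W}

/-- If both faces had edges, `u + x`, `v + x` and `u + y` would lie on the segment from `p` to `q`,
making the two edges parallel. So one face is a point, which can be cancelled. -/
lemma Transverse.edge_cases (hPQ : Transverse P Q) (hP : IsPolytope P) (hQ : IsPolytope Q)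
    {p q : W} {c : StrongDual ℝ W} (hpq : p ≠ q) (hc : maxFace (P + Q) c = segment ℝ p q) :
    (∃ u v x, u ≠ v ∧ maxFace P c = segment ℝ u v ∧ maxFace Q c = {x} ∧ p = u + x ∧ q = v + x) ∨
    ∃ u x y, x ≠ y ∧ maxFace P c = {u} ∧ maxFace Q c = segment ℝ x y ∧ p = u + x ∧ q = u + y := by
  rw [hP.maxFace_add hQ] at hc
  have hcancel : ∀ x : W, segment ℝ p q = segment ℝ (p - x) (q - x) + {x} := fun x => by
    rw [segment_add_singleton, sub_add_cancel, sub_add_cancel]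
  have hinj : ∀ (A B : Set W) (x : W), A + {x} = B + {x} → A = B := fun A B x h => by
    rw [Set.add_singleton, Set.add_singleton] at h
    exact (Set.image_injective.2 (add_left_injective x)) h
  by_cases hE : ∃ x y, IsEdge (maxFace Q c) x y
  · by_cases hE' : ∃ u v, IsEdge (maxFace P c) u v
    · exfalso
      obtain ⟨x, y, hxy⟩ := hE
      obtain ⟨u, v, huv⟩ := hE'
      have hx := (hxy.left_mem (hQ.face c)).1
      have hy := (hxy.right_mem (hQ.face c)).1
      have hu := (huv.left_mem (hP.face c)).1
      have hv := (huv.right_mem (hP.face c)).1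
      have hspan : ∀ a ∈ segment ℝ p q, ∀ b ∈ segment ℝ p q, b - a ∈ Submodule.span ℝ {q - p} :=
        fun a ha b hb => by
          rw [← vectorSpan_segment]
          exact vsub_mem_vectorSpan ℝ hb ha
      have h1 := hspan _ (hc ▸ Set.add_mem_add hu hx) _ (hc ▸ Set.add_mem_add hv hx)
      have h2 := hspan _ (hc ▸ Set.add_mem_add hu hx) _ (hc ▸ Set.add_mem_add hu hy)
      rw [add_sub_add_right_eq_sub] at h1
      rw [add_sub_add_left_eq_sub] at h2
      obtain ⟨s, hs⟩ := Submodule.mem_span_singleton.1 h1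
      obtain ⟨t, ht⟩ := Submodule.mem_span_singleton.1 h2
      have hs0 : s ≠ 0 := by
        rintro rfl
        rw [zero_smul] at hs
        exact huv.1 (sub_eq_zero.1 hs.symm).symm
      refine hPQ.notParallel u v (hP.isEdge_of_maxFace huv) x y (hQ.isEdge_of_maxFace hxy)
        (Submodule.mem_span_singleton.2 ⟨t * s⁻¹, ?_⟩)
      rw [← hs, ← ht, smul_smul, mul_assoc, inv_mul_cancel₀ hs0, mul_one]
    · push Not at hE'
      obtain ⟨u, hu⟩ := (hP.face c).eq_singleton_of_no_edge hE'
      refine .inr ⟨u, p - u, q - u, fun h => hpq (sub_left_injective h), hu, ?_, ?_, ?_⟩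
      · refine hinj _ _ u ?_
        rw [← hcancel, ← hc, hu, add_comm]
      · abel
      · abel
  · push Not at hE
    obtain ⟨x, hx⟩ := (hQ.face c).eq_singleton_of_no_edge hE
    refine .inl ⟨p - x, q - x, x, fun h => hpq (sub_left_injective h), ?_, hx, ?_, ?_⟩
    · refine hinj _ _ x ?_
      rw [← hcancel, ← hc, hx]
    · abel
    · abel

lemma toSet_add_singleton {u v : Vertex P} (h : (edgeGraph P).Adj u v) (x : W) :
    (mkEdge h).toSet + {x} = segment ℝ ((u : W) + x) (v + x) := by
  rw [toSet_mkEdge, segment_add_singleton]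

lemma singleton_add_toSet {u v : Vertex P} (h : (edgeGraph P).Adj u v) (x : W) :
    {x} + (mkEdge h).toSet = segment ℝ (x + u : W) (x + v) := by
  rw [add_comm, toSet_add_singleton, add_comm x, add_comm x]

/-- Each edge of `P + Q` is of the form `e + x` or `u + f`. -/
lemma Transverse.mkEdge_cases (hPQ : Transverse P Q) (hP : IsPolytope P) (hQ : IsPolytope Q)
    {p q : Vertex (P + Q)} (h : (edgeGraph (P + Q)).Adj p q) :
    (∃ (u v : Vertex P) (huv : (edgeGraph P).Adj u v) (x : Vertex Q) (c : StrongDual ℝ W),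
      maxFace P c = segment ℝ (u : W) v ∧ maxFace Q c = {(x : W)} ∧ (p : W) = u + x ∧
        (q : W) = v + x ∧ mkEdge h ∈ edgeClass P Q (.inl (mkEdge huv))) ∨
    ∃ (x y : Vertex Q) (hxy : (edgeGraph Q).Adj x y) (u : Vertex P) (c : StrongDual ℝ W),
      maxFace Q c = segment ℝ (x : W) y ∧ maxFace P c = {(u : W)} ∧ (p : W) = u + x ∧
        (q : W) = u + y ∧ mkEdge h ∈ edgeClass P Q (.inr (mkEdge hxy)) := by
  obtain ⟨hne, c, hc⟩ := adj_iff.1 h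
  rcases hPQ.edge_cases hP hQ hne hc with ⟨u, v, x, huv, hu, hx, hp, hq⟩ |
    ⟨u, x, y, hxy, hu, hx, hp, hq⟩
  · have he : IsEdge P u v := ⟨huv, c, hu⟩
    have hadj : (edgeGraph P).Adj ⟨u, he.left_mem hP⟩ ⟨v, he.right_mem hP⟩ := adj_iff.2 he
    refine .inl ⟨_, _, hadj, ⟨x, mem_exposedPoints_iff.2 ⟨c, hx⟩⟩, c, hu, hx, hp, hq,
      ⟨⟨x, mem_exposedPoints_iff.2 ⟨c, hx⟩⟩, ?_⟩⟩
    rw [toSet_mkEdge, toSet_add_singleton, hp, hq]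
  · have he : IsEdge Q x y := ⟨hxy, c, hx⟩
    have hadj : (edgeGraph Q).Adj ⟨x, he.left_mem hQ⟩ ⟨y, he.right_mem hQ⟩ := adj_iff.2 he
    refine .inr ⟨_, _, hadj, ⟨u, mem_exposedPoints_iff.2 ⟨c, hu⟩⟩, c, hx, hu, hp, hq,
      ⟨⟨u, mem_exposedPoints_iff.2 ⟨c, hu⟩⟩, ?_⟩⟩
    rw [toSet_mkEdge, singleton_add_toSet, hp, hq]

lemma Edge.toSet_subset (hP : IsPolytope P) (e : Edge P) : e.toSet ⊆ P := by
  obtain ⟨u, v, h, rfl⟩ := e.exists_eq_mkEdge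
  rw [toSet_mkEdge]
  exact hP.convex.segment_subset u.2.1 v.2.1

/-- A vertex of a sum splits uniquely. If `g` were both `e + x` and `u + f`, each of its endpoints
would be `u + x`; within one summand, a common endpoint determines the translation, which cancels.
-/
lemma edgeClass_unique (hP : IsPolytope P) (hQ : IsPolytope Q) {g : Edge (P + Q)}
    {a b : Edge P ⊕ Edge Q} (ha : g ∈ edgeClass P Q a) (hb : g ∈ edgeClass P Q b) : a = b := by
  obtain ⟨p, q, hpq, hg⟩ := g.exists_eq_mkEdge
  have hpg : (p : W) ∈ g.toSet := by rw [hg, toSet_mkEdge]; exact left_mem_segment ℝ _ _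
  have hqg : (q : W) ∈ g.toSet := by rw [hg, toSet_mkEdge]; exact right_mem_segment ℝ _ _
  have hinj : ∀ (A B : Set W) (x : W), A + {x} = B + {x} → A = B := fun A B x h => by
    rw [Set.add_singleton, Set.add_singleton] at h
    exact (Set.image_injective.2 (add_left_injective x)) h
  have hmix : ∀ (e : Edge P) (f : Edge Q), g ∈ edgeClass P Q (.inl e) →
      g ∉ edgeClass P Q (.inr f) := by
    rintro e f ⟨x, hx⟩ ⟨u, hu⟩
    have key : ∀ r ∈ (P + Q).exposedPoints ℝ, r ∈ g.toSet → r = u + x := by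
      intro r hr hrg
      obtain ⟨a, ha, _, rfl, har⟩ := Set.mem_add.1 (hx ▸ hrg)
      obtain ⟨_, rfl, b, hb, hbr⟩ := Set.mem_add.1 (hu ▸ hrg)
      rw [← (add_unique_of_exposed hr (e.toSet_subset hP ha) x.2.1 u.2.1 (f.toSet_subset hQ hb)
        har hbr).1, har]
    exact hpq.1 (Subtype.ext ((key p p.2 hpg).trans (key q q.2 hqg).symm))
  rcases a with e | e <;> rcases b with f | f
  · obtain ⟨x, hx⟩ := ha
    obtain ⟨y, hy⟩ := hb
    obtain ⟨a, ha, _, rfl, hap⟩ := Set.mem_add.1 (hx ▸ hpg)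
    obtain ⟨b, hb, _, rfl, hbp⟩ := Set.mem_add.1 (hy ▸ hpg)
    have hxy := (add_unique_of_exposed p.2 (e.toSet_subset hP ha) x.2.1 (f.toSet_subset hP hb) y.2.1
      hap hbp).2
    rw [← hxy] at hy
    exact congrArg _ (Edge.toSet_injective hP (hinj _ _ _ (hx.symm.trans hy)))
  · exact absurd hb (hmix e f ha)
  · exact absurd ha (hmix f e hb)
  · obtain ⟨x, hx⟩ := ha
    obtain ⟨y, hy⟩ := hb
    obtain ⟨_, rfl, a, ha, hap⟩ := Set.mem_add.1 (hx ▸ hpg)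
    obtain ⟨_, rfl, b, hb, hbp⟩ := Set.mem_add.1 (hy ▸ hpg)
    have hxy := (add_unique_of_exposed p.2 x.2.1 (e.toSet_subset hQ ha) y.2.1 (f.toSet_subset hQ hb)
      hap hbp).1
    rw [← hxy] at hy
    refine congrArg _ (Edge.toSet_injective hQ (hinj _ _ (x : W) ?_))
    rw [add_comm e.toSet, add_comm f.toSet]
    exact hx.symm.trans hy

lemma Transverse.exists_mem_edgeClass_inl [FiniteDimensional ℝ W] (hPQ : Transverse P Q)
    (hP : IsPolytope P) (hQ : IsPolytope Q) (e : Edge P) : ∃ g, g ∈ edgeClass P Q (.inl e) := by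
  obtain ⟨u, v, h, rfl⟩ := e.exists_eq_mkEdge
  obtain ⟨c, x, hc, hx⟩ := hPQ.exists_vertex_over_edge hP hQ (adj_iff.1 h)
  have hE := isEdge_add_right (adj_iff.1 h).1 hc hx
  have hadj : (edgeGraph (P + Q)).Adj ⟨_, hE.left_mem (hP.add hQ)⟩ ⟨_, hE.right_mem (hP.add hQ)⟩ :=
    adj_iff.2 hE
  refine ⟨mkEdge hadj, ⟨x, mem_exposedPoints_iff.2 ⟨c, hx⟩⟩, ?_⟩
  rw [toSet_mkEdge, toSet_add_singleton]

lemma Transverse.exists_mem_edgeClass_inr [FiniteDimensional ℝ W] (hPQ : Transverse P Q)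
    (hP : IsPolytope P) (hQ : IsPolytope Q) (e : Edge Q) : ∃ g, g ∈ edgeClass P Q (.inr e) := by
  obtain ⟨u, v, h, rfl⟩ := e.exists_eq_mkEdge
  obtain ⟨c, x, hc, hx⟩ := hPQ.symm.exists_vertex_over_edge hQ hP (adj_iff.1 h)
  have hE : IsEdge (P + Q) (u + x) (v + x) :=
    add_comm Q P ▸ isEdge_add_right (adj_iff.1 h).1 hc hx
  have hadj : (edgeGraph (P + Q)).Adj ⟨_, hE.left_mem (hP.add hQ)⟩ ⟨_, hE.right_mem (hP.add hQ)⟩ :=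
    adj_iff.2 hE
  refine ⟨mkEdge hadj, ⟨x, mem_exposedPoints_iff.2 ⟨c, hx⟩⟩, ?_⟩
  rw [toSet_mkEdge, singleton_add_toSet, add_comm x, add_comm x]

lemma Transverse.exists_classMap [FiniteDimensional ℝ W] (hPQ : Transverse P Q)
    (hP : IsPolytope P) (hQ : IsPolytope Q) :
    ∃ cl : Edge (P + Q) → Edge P ⊕ Edge Q, Function.Surjective cl ∧
      ∀ g a, cl g = a ↔ g ∈ edgeClass P Q a := by
  have : ∀ g, ∃ a, g ∈ edgeClass P Q a := by
    intro g
    obtain ⟨p, q, h, rfl⟩ := g.exists_eq_mkEdge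
    rcases hPQ.mkEdge_cases hP hQ h with ⟨u, v, huv, x, c, -, -, -, -, hg⟩ |
      ⟨u, v, huv, x, c, -, -, -, -, hg⟩
    exacts [⟨_, hg⟩, ⟨_, hg⟩]
  choose cl hcl using this
  have hiff : ∀ g a, cl g = a ↔ g ∈ edgeClass P Q a := fun g a =>
    ⟨fun h => h ▸ hcl g, fun h => edgeClass_unique hP hQ (hcl g) h⟩
  refine ⟨cl, ?_, hiff⟩
  rintro (e | e)
  · obtain ⟨g, hg⟩ := hPQ.exists_mem_edgeClass_inl hP hQ e
    exact ⟨g, (hiff g _).2 hg⟩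
  · obtain ⟨g, hg⟩ := hPQ.exists_mem_edgeClass_inr hP hQ e
    exact ⟨g, (hiff g _).2 hg⟩

lemma exists_decomposition (P Q : Set W) :
    ∃ α β : W → W, ∀ u ∈ P, ∀ x ∈ Q, u + x ∈ (P + Q).exposedPoints ℝ →
      α (u + x) = u ∧ β (u + x) = x := by
  have : ∀ p, p ∈ (P + Q).exposedPoints ℝ → ∃ u x, u ∈ P ∧ x ∈ Q ∧ u + x = p := fun p hp => by
    obtain ⟨u, hu, x, hx, h⟩ := Set.mem_add.1 hp.1
    exact ⟨u, x, hu, hx, h⟩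
  choose! α β hα hβ h using this
  exact ⟨α, β, fun u hu x hx hux =>
    add_unique_of_exposed hux (hα _ hux) (hβ _ hux) hu hx (h _ hux) rfl⟩

/-- The deformation cone of `P + Q` consists of the lifts of pairs of edge-deformation vectors. -/
theorem Transverse.mem_defoCone_add_iff [FiniteDimensional ℝ W] (hPQ : Transverse P Q)
    (hP : IsPolytope P) (hQ : IsPolytope Q) {cl : Edge (P + Q) → Edge P ⊕ Edge Q}
    (hcl : ∀ g a, cl g = a ↔ g ∈ edgeClass P Q a) {lam : Edge (P + Q) → ℝ} :
    lam ∈ defoCone (P + Q) ↔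
      ∃ a ∈ defoCone P, ∃ b ∈ defoCone Q, lam = fun g => Sum.elim a b (cl g) := by
  rw [mem_defoCone_iff (hP.add hQ)]
  constructor
  · rintro ⟨ψ, hψ, hlam⟩
    obtain ⟨ψ₁, hψ₁, h₁⟩ := hPQ.exists_isDefo_left hP hQ hψ
    obtain ⟨ψ₂, hψ₂, h₂⟩ := hPQ.symm.exists_isDefo_left hQ hP (add_comm P Q ▸ hψ)
    obtain ⟨a, ha0, ha⟩ := hψ₁.exists_hasEdgeVector
    obtain ⟨b, hb0, hb⟩ := hψ₂.exists_hasEdgeVector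
    refine ⟨a, (mem_defoCone_iff hP).2 ⟨ψ₁, hψ₁, ha⟩, b, (mem_defoCone_iff hQ).2 ⟨ψ₂, hψ₂, hb⟩, ?_⟩
    funext g
    obtain ⟨p, q, h, rfl⟩ := g.exists_eq_mkEdge
    rcases hPQ.mkEdge_cases hP hQ h with ⟨u, v, huv, x, c, hc, hx, hp, hq, hg⟩ |
      ⟨x, y, hxy, u, c, hc, hu, hp, hq, hg⟩
    · rw [(hcl _ _).2 hg, Sum.elim_inl]
      have hne : (v : W) - u ≠ 0 := sub_ne_zero.2 (adj_iff.1 huv).1.symm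
      refine smul_left_injective ℝ hne ?_
      have := hlam p q h
      rw [hp, hq, add_sub_add_right_eq_sub, h₁ u v x c (adj_iff.1 huv).1 hc hx] at this
      exact this.trans (ha u v huv).symm
    · rw [(hcl _ _).2 hg, Sum.elim_inr]
      have hne : (y : W) - x ≠ 0 := sub_ne_zero.2 (adj_iff.1 hxy).1.symm
      refine smul_left_injective ℝ hne ?_
      have := hlam p q h
      rw [hp, hq, add_sub_add_left_eq_sub, add_comm (u : W), add_comm (u : W),
        h₂ x y u c (adj_iff.1 hxy).1 hc hu] at this
      exact this.trans (hb x y hxy).symm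
  · rintro ⟨a, ha, b, hb, rfl⟩
    obtain ⟨ψ₁, hψ₁, ha'⟩ := (mem_defoCone_iff hP).1 ha
    obtain ⟨ψ₂, hψ₂, hb'⟩ := (mem_defoCone_iff hQ).1 hb
    obtain ⟨a', ha0, ha''⟩ := hψ₁.exists_hasEdgeVector
    obtain rfl := ha'.unique ha''
    obtain ⟨b', hb0, hb''⟩ := hψ₂.exists_hasEdgeVector
    obtain rfl := hb'.unique hb''
    obtain ⟨α, β, hαβ⟩ := exists_decomposition P Q
    -- Along `e + x` only the `P`-part of the vertex changes, along `u + f` only the `Q`-part.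
    have key : HasEdgeVector (P + Q) (fun p => ψ₁ (α p) + ψ₂ (β p))
        (fun g => Sum.elim a b (cl g)) := by
      intro p q h
      rcases hPQ.mkEdge_cases hP hQ h with ⟨u, v, huv, x, c, hc, hx, hp, hq, hg⟩ |
        ⟨x, y, hxy, u, c, hc, hu, hp, hq, hg⟩
      · simp only [(hcl _ _).2 hg, Sum.elim_inl]
        obtain ⟨e1, e2⟩ := hαβ u u.2.1 x x.2.1 (hp ▸ p.2)
        obtain ⟨e3, e4⟩ := hαβ v v.2.1 x x.2.1 (hq ▸ q.2)
        rw [hp, hq, e1, e2, e3, e4, add_sub_add_right_eq_sub, add_sub_add_right_eq_sub]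
        exact ha' u v huv
      · simp only [(hcl _ _).2 hg, Sum.elim_inr]
        obtain ⟨e1, e2⟩ := hαβ u u.2.1 x x.2.1 (hp ▸ p.2)
        obtain ⟨e3, e4⟩ := hαβ u u.2.1 y y.2.1 (hq ▸ q.2)
        rw [hp, hq, e1, e2, e3, e4, add_sub_add_left_eq_sub, add_sub_add_left_eq_sub]
        exact hb' x y hxy
    refine ⟨_, key.isDefo (hP.add hQ) fun g => ?_, key⟩
    rcases cl g with e | e
    exacts [ha0 e, hb0 e]

end EdgeClass

/-! ### The cone and the edge dependencies of a sum of two polytopes -/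

lemma conesLinearlyIsomorphic_of_injective {V V' : Type*} [AddCommGroup V] [Module ℝ V]
    [AddCommGroup V'] [Module ℝ V'] {C : PointedCone ℝ V} {D : PointedCone ℝ V'}
    (Φ : V' →ₗ[ℝ] V) (hΦ : Function.Injective Φ) (h : ∀ x, x ∈ C ↔ ∃ y ∈ D, Φ y = x) :
    ConesLinearlyIsomorphic C D := by
  have hCD : Submodule.span ℝ (C : Set V) = (Submodule.span ℝ (D : Set V')).map Φ := by
    rw [Submodule.map_span]
    congr 1
    ext x
    exact h x
  let f := (LinearEquiv.ofEq _ _ hCD).trans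
    (Submodule.equivMapOfInjective Φ hΦ (Submodule.span ℝ (D : Set V'))).symm
  refine ⟨f, fun x => ?_⟩
  have hx : Φ (f x : V') = x := by
    have := congrArg Subtype.val ((Submodule.equivMapOfInjective Φ hΦ
      (Submodule.span ℝ (D : Set V'))).apply_symm_apply (LinearEquiv.ofEq _ _ hCD x))
    exact this
  rw [h]
  constructor
  · rintro ⟨y, hy, hyx⟩
    rwa [← hΦ (hyx.trans hx.symm)]
  · exact fun hf => ⟨_, hf, hx⟩

/-- The deformation cone and the graph of edge dependencies of a sum in parallelogramic
position. -/
theorem ParallelogramicPosition.defoCone_add [FiniteDimensional ℝ W] {P Q : Set W}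
    (hP : IsPolytope P) (hQ : IsPolytope Q) (h : ParallelogramicPosition P Q) :
    ConesLinearlyIsomorphic (defoCone (P + Q))
        (Submodule.prod (defoCone P) (defoCone Q) :
          PointedCone ℝ ((Edge P → ℝ) × (Edge Q → ℝ))) ∧
      ∃ (s : Setoid (Edge (P + Q))) (φ : Quotient s ≃ Edge P ⊕ Edge Q),
        (∀ a : Edge P ⊕ Edge Q, {g | φ (Quotient.mk s g) = a} = edgeClass P Q a) ∧
        dependencyGraph (P + Q) =
          LoopGraph.lift s
            (LoopGraph.relabel φ (LoopGraph.union (dependencyGraph P) (dependencyGraph Q))) := by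
  have hPQ := h.transverse hP hQ
  obtain ⟨cl, hsurj, hcl⟩ := hPQ.exists_classMap hP hQ
  have hmem := fun lam => hPQ.mem_defoCone_add_iff hP hQ hcl (lam := lam)
  constructor
  · let Φ : ((Edge P → ℝ) × (Edge Q → ℝ)) →ₗ[ℝ] (Edge (P + Q) → ℝ) :=
      { toFun := fun ab g => Sum.elim ab.1 ab.2 (cl g)
        map_add' := fun x y => by
          funext g
          rcases hg : cl g with e | e <;> simp [hg]
        map_smul' := fun r x => by
          funext g
          rcases hg : cl g with e | e <;> simp [hg] }
    refine conesLinearlyIsomorphic_of_injective Φ (fun x y hxy => ?_) fun lam => ?_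
    · have key : ∀ a, Sum.elim x.1 x.2 a = Sum.elim y.1 y.2 a := fun a => by
        obtain ⟨g, rfl⟩ := hsurj a
        exact congrFun hxy g
      exact Prod.ext (funext fun e => key (.inl e)) (funext fun e => key (.inr e))
    · rw [hmem]
      constructor
      · rintro ⟨a, ha, b, hb, rfl⟩
        exact ⟨(a, b), ⟨ha, hb⟩, rfl⟩
      · rintro ⟨⟨a, b⟩, ⟨ha, hb⟩, rfl⟩
        exact ⟨a, ha, b, hb, rfl⟩
  · refine ⟨Setoid.ker cl, Setoid.quotientKerEquivOfSurjective cl hsurj, fun a => ?_, ?_⟩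
    · ext g
      exact hcl g a
    · have harc : ∀ g g', (∀ lam ∈ defoCone (P + Q), lam g = lam g') ↔
          Sum.LiftRel (dependencyGraph P).Arc (dependencyGraph Q).Arc (cl g) (cl g') := by
        intro g g'
        have : (∀ lam ∈ defoCone (P + Q), lam g = lam g') ↔ ∀ a ∈ defoCone P, ∀ b ∈ defoCone Q,
            (Sum.elim a b (cl g) : ℝ) = Sum.elim a b (cl g') := by
          constructor
          · exact fun H a ha b hb => H _ ((hmem _).2 ⟨a, ha, b, hb, rfl⟩)
          · intro H lam hlam
            obtain ⟨a, ha, b, hb, rfl⟩ := (hmem _).1 hlam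
            exact H a ha b hb
        rw [this]
        rcases cl g with e | e <;> rcases cl g' with f | f
        · simp only [Sum.elim_inl, Sum.liftRel_inl_inl]
          exact ⟨fun H a ha => H a ha 0 (Submodule.zero_mem _), fun H a ha _ _ => H a ha⟩
        · simp only [Sum.elim_inl, Sum.elim_inr, Sum.not_liftRel_inl_inr, iff_false]
          intro H
          -- Keeping `P` and contracting `Q` to a point separates edges coming from different
          -- summands.
          have := H 1 (one_mem_defoCone hP) 0 (Submodule.zero_mem _)
          simp at this
        · simp only [Sum.elim_inl, Sum.elim_inr, Sum.not_liftRel_inr_inl, iff_false]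
          intro H
          have := H 1 (one_mem_defoCone hP) 0 (Submodule.zero_mem _)
          simp at this
        · simp only [Sum.elim_inr, Sum.liftRel_inr_inr]
          exact ⟨fun H a ha => H 0 (Submodule.zero_mem _) a ha, fun H _ _ b hb => H b hb⟩
      have hArc : (dependencyGraph (P + Q)).Arc = (LoopGraph.lift (Setoid.ker cl)
          (LoopGraph.relabel (Setoid.quotientKerEquivOfSurjective cl hsurj)
            (LoopGraph.union (dependencyGraph P) (dependencyGraph Q)))).Arc := by
        funext g g'
        exact propext (harc g g')
      have hext : ∀ {N : Type _} (G H : LoopGraph N), G.Arc = H.Arc → G = H := by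
        rintro N ⟨A, hA⟩ ⟨B, hB⟩ (rfl : A = B)
        rfl
      exact hext _ _ hArc

/-! ### Framework deformations and Minkowski summands -/

/-- Along a `c`-improving edge, `c ∘ ψ` does not decrease. At a counterexample of largest `c`, the
improved neighbour must have the image `ψ v`; then the edge is contracted and the counterexample has
that image too. -/
lemma IsDefo.lt_or_eq {P : Set W} (hP : IsPolytope P) {ψ : W → W} (hψ : IsDefo P ψ)
    {c : StrongDual ℝ W} {v : W} (hv : maxFace P c = {v}) :
    ∀ u ∈ P.exposedPoints ℝ, c (ψ u) < c (ψ v) ∨ ψ u = ψ v := by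
  by_contra! hcon
  obtain ⟨u₀, hu₀, hlt₀, hne₀⟩ := hcon
  have hfin : {u ∈ P.exposedPoints ℝ | c (ψ v) ≤ c (ψ u) ∧ ψ u ≠ ψ v}.Finite :=
    hP.finite.subset fun p hp => hp.1
  obtain ⟨u, ⟨hu, hle, hne⟩, hmax⟩ := exists_max_of_finite hfin ⟨u₀, hu₀, hlt₀, hne₀⟩ c
  have huv : u ≠ v := by rintro rfl; exact hne rfl
  obtain ⟨w, huw, hlt⟩ := hP.exists_improving_edge hu (c := c) (by rw [hv]; exact huv)
  obtain ⟨l, hl, h⟩ := hψ u w huw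
  have hval : c (ψ w) = c (ψ u) + l * (c w - c u) := by
    rw [← map_sub, ← smul_eq_mul, ← map_smul, ← h, map_sub]
    ring
  have hge : c (ψ u) ≤ c (ψ w) := by
    rw [hval]
    linarith [mul_nonneg hl (sub_pos.2 hlt).le]
  refine (hmax w ⟨huw.right_mem hP, hle.trans hge, fun hw => ?_⟩).not_gt hlt
  have hl0 : l = 0 := by
    have : l * (c w - c u) ≤ 0 := by
      rw [hw] at hval
      linarith
    by_contra hl'
    exact this.not_gt (mul_pos (lt_of_le_of_ne hl (Ne.symm hl')) (sub_pos.2 hlt))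
  rw [hl0, zero_smul, sub_eq_zero] at h
  exact hne (h.symm.trans hw)

/-- Tilt `c` slightly so that it exposes `v` alone, and pass to the limit. -/
lemma IsDefo.le_of_mem {P : Set W} (hP : IsPolytope P) {ψ : W → W} (hψ : IsDefo P ψ)
    {c : StrongDual ℝ W} {u v : W} (hu : u ∈ P.exposedPoints ℝ) (hv : v ∈ P.exposedPoints ℝ)
    (hvc : v ∈ maxFace P c) : c (ψ u) ≤ c (ψ v) := by
  obtain ⟨c₀, hc₀⟩ := mem_exposedPoints_iff.1 hv
  have h1 : Continuous fun c' : StrongDual ℝ W => c' (ψ u) := by fun_prop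
  have h2 : Continuous fun c' : StrongDual ℝ W => c' (ψ v) := by fun_prop
  refine le_of_tendsto_of_tendsto ((h1.tendsto c).comp (tendsto_add_smul c c₀))
    ((h2.tendsto c).comp (tendsto_add_smul c c₀)) ?_
  filter_upwards [hP.eventually_maxFace_maxFace c c₀] with ε hε
  have hface : maxFace P (c + ε • c₀) = {v} := by
    rw [hε]
    exact maxFace_of_subset (maxFace_subset P c) hc₀ (Set.singleton_nonempty v)
      (Set.singleton_subset_iff.2 hvc)
  rcases hψ.lt_or_eq hP hface u hu with h | h
  · exact h.le
  · simp only [Function.comp_apply, h, le_refl]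

/-- The polytope spanned by the images of the vertices under a framework deformation. -/
def defoHull (P : Set W) (ψ : W → W) : Set W := convexHull ℝ (ψ '' P.exposedPoints ℝ)

lemma IsPolytope.defoHull {P : Set W} (hP : IsPolytope P) (ψ : W → W) :
    IsPolytope (defoHull P ψ) :=
  ⟨_, hP.finite.image ψ, hP.exposedPoints_nonempty.image ψ, rfl⟩

lemma IsDefo.maxFace_defoHull {P : Set W} (hP : IsPolytope P) {ψ : W → W} (hψ : IsDefo P ψ)
    {c : StrongDual ℝ W} {v : W} (hv : maxFace P c = {v}) : maxFace (defoHull P ψ) c = {ψ v} := by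
  have hvP : v ∈ P.exposedPoints ℝ := mem_exposedPoints_iff.2 ⟨c, hv⟩
  have h := hψ.lt_or_eq hP hv
  have hex : ∃ y ∈ ψ '' P.exposedPoints ℝ, c y = c (ψ v) := ⟨ψ v, ⟨v, hvP, rfl⟩, rfl⟩
  rw [PolytopeDeformation.defoHull, maxFace_convexHull ?_ hex]
  · have : {y ∈ ψ '' P.exposedPoints ℝ | c y = c (ψ v)} = {ψ v} := by
      ext y
      constructor
      · rintro ⟨⟨u, hu, rfl⟩, hy⟩
        exact (h u hu).resolve_left hy.not_lt
      · rintro rfl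
        exact ⟨⟨v, hvP, rfl⟩, rfl⟩
    rw [this, convexHull_singleton]
  · rintro _ ⟨u, hu, rfl⟩
    rcases h u hu with h | h
    · exact h.le
    · rw [h]

lemma finite_edge {P : Set W} (hP : IsPolytope P) : Finite (Edge P) := by
  have : Finite (Vertex P) := hP.finite.to_subtype
  infer_instance

/-- With `N` bounding the edge factors, `N⁻¹ • ψ` and `id - N⁻¹ • ψ` are both framework deformations
with sum `id`. A vertex of `P` maximizing `c` gives maximizers on both hulls, so the hulls sum to
`P`. -/
lemma IsDefo.isDeformation_defoHull {P : Set W} (hP : IsPolytope P) {ψ : W → W}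
    (hψ : IsDefo P ψ) : IsDeformation P (defoHull P ψ) := by
  obtain ⟨lam, hlam0, hlam⟩ := hψ.exists_hasEdgeVector
  have := finite_edge hP
  obtain ⟨M, hM⟩ := (Set.finite_range lam).bddAbove
  set N := max M 1
  have hN : 0 < N := lt_of_lt_of_le one_pos (le_max_right _ _)
  have hle : ∀ e, N⁻¹ * lam e ≤ 1 := fun e => by
    rw [inv_mul_le_one₀ hN]
    exact (hM ⟨e, rfl⟩).trans (le_max_left _ _)
  have hψ' : IsDefo P (fun v => v - N⁻¹ • ψ v) := by
    refine HasEdgeVector.isDefo hP (lam := fun e => 1 - N⁻¹ * lam e) (fun u v h => ?_)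
      fun e => sub_nonneg.2 (hle e)
    rw [sub_smul, one_smul, mul_smul, hlam u v h, smul_sub]
    abel
  refine ⟨hP.defoHull ψ, defoHull P fun v => v - N⁻¹ • ψ v, hP.defoHull _, N⁻¹, inv_pos.2 hN, ?_⟩
  apply Set.Subset.antisymm
  · refine hP.subset_of_vertices (((hP.defoHull ψ).smul _).add (hP.defoHull _)).convex fun v hv => ?_
    refine Set.mem_add.2 ⟨N⁻¹ • ψ v, Set.smul_mem_smul_set
      (subset_convexHull ℝ _ ⟨v, hv, rfl⟩), v - N⁻¹ • ψ v, subset_convexHull ℝ _ ⟨v, hv, rfl⟩, ?_⟩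
    abel
  · intro z hz
    obtain ⟨_, ⟨q, hq, rfl⟩, r, hr, rfl⟩ := Set.mem_add.1 hz
    by_contra hzP
    obtain ⟨c, s, h1, h2⟩ := geometric_hahn_banach_closed_point hP.convex hP.isCompact.isClosed hzP
    obtain ⟨v, hv⟩ := (hP.face c).exposedPoints_nonempty
    have hvP := hP.exposedPoints_maxFace_subset c hv
    have hmax : ∀ {φ : W → W}, IsDefo P φ → ∀ y ∈ defoHull P φ, c y ≤ c (φ v) := by
      intro φ hφ y hy
      refine convexHull_min (t := {y | c y ≤ c (φ v)}) ?_
        (convex_halfSpace_le c.isLinear _) hy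
      rintro _ ⟨u, hu, rfl⟩
      exact hφ.le_of_mem hP hu hvP hv.1
    have e1 := mul_le_mul_of_nonneg_left (hmax hψ q hq) (inv_pos.2 hN).le
    have e2 := hmax hψ' r hr
    have e3 := h1 v hvP.1
    simp only [map_add, map_sub, map_smul, smul_eq_mul] at h2 e2
    linarith

lemma maxFace_smul {P : Set W} {a : ℝ} (ha : 0 < a) (c : StrongDual ℝ W) :
    maxFace (a • P) c = a • maxFace P c := by
  ext z
  constructor
  · rintro ⟨⟨x, hx, rfl⟩, hmax⟩
    refine ⟨x, ⟨hx, fun y hy => ?_⟩, rfl⟩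
    have := hmax (a • y) (Set.smul_mem_smul_set hy)
    simp only [map_smul, smul_eq_mul] at this
    exact le_of_mul_le_mul_left this ha
  · rintro ⟨x, hx, rfl⟩
    refine ⟨Set.smul_mem_smul_set hx.1, ?_⟩
    rintro _ ⟨y, hy, rfl⟩
    simp only [map_smul, smul_eq_mul]
    exact mul_le_mul_of_nonneg_left (hx.2 y hy) ha.le

lemma smul_mem_maxFace_smul {P : Set W} {a : ℝ} (ha : 0 ≤ a) {c : StrongDual ℝ W} {v : W}
    (hv : v ∈ maxFace P c) : a • v ∈ maxFace (a • P) c := by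
  refine ⟨Set.smul_mem_smul_set hv.1, ?_⟩
  rintro _ ⟨y, hy, rfl⟩
  simp only [map_smul, smul_eq_mul]
  exact mul_le_mul_of_nonneg_left (hv.2 y hy) ha

lemma add_singleton_mem_maxFace {P : Set W} {c : StrongDual ℝ W} {v : W}
    (hv : v ∈ maxFace P c) (t : W) : v + t ∈ maxFace (P + {t}) c := by
  rw [maxFace_add ⟨v, hv⟩ (by rw [maxFace_singleton]; exact ⟨t, rfl⟩), maxFace_singleton]
  exact Set.add_mem_add hv rfl

/-- The hull of the image is some `c • P + {t}`; a functional exposing `v` exposes `ψ v` there, and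
`c • v + t` is also maximal, even if `c = 0`. -/
lemma IsIndecomposable.exists_eq_smul_add {P : Set W} (h : IsIndecomposable P) {ψ : W → W}
    (hψ : IsDefo P ψ) :
    ∃ c : ℝ, 0 ≤ c ∧ ∃ t : W, ∀ v ∈ P.exposedPoints ℝ, ψ v = c • v + t := by
  obtain ⟨c, hc, t, hQ⟩ := h.2.2 _ (hψ.isDeformation_defoHull h.1)
  refine ⟨c, hc, t, fun v hv => ?_⟩
  obtain ⟨η, hη⟩ := mem_exposedPoints_iff.1 hv
  have h1 := hψ.maxFace_defoHull h.1 hη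
  have h2 := add_singleton_mem_maxFace (smul_mem_maxFace_smul hc (hη ▸ rfl : v ∈ maxFace P η)) t
  rw [← hQ, h1] at h2
  exact h2.symm

/-- `f` sends the vertex `P^c` to the vertex `Q^c`. -/
def IsVertexMap (P Q : Set W) (f : W → W) : Prop :=
  ∀ v c, maxFace P c = {v} → maxFace Q c = {f v}

/-- Writing `P = a • Q + R`, the map is `a⁻¹` times the `a • Q`-part of a vertex. On an edge from `q
+ r` to `q' + r'`, the mixed point `q' + r` lies in the edge, so `q' - q` is a multiple in `[0, 1]`
of the edge vector. -/
lemma IsDeformation.exists_vertexMap {P Q : Set W} (h : IsDeformation P Q) :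
    ∃ f : W → W, IsVertexMap P Q f ∧ IsDefo P f := by
  obtain ⟨hQ, R, hR, a, ha, rfl⟩ := h
  have haQ := hQ.smul a
  obtain ⟨α, β, hαβ⟩ := exists_decomposition (a • Q) R
  refine ⟨fun p => a⁻¹ • α p, fun v c hv => ?_, fun u v huv => ?_⟩
  · have hvP : v ∈ (a • Q + R).exposedPoints ℝ := mem_exposedPoints_iff.2 ⟨c, hv⟩
    rw [haQ.maxFace_add hR] at hv
    obtain ⟨q, r, hq, hr, rfl⟩ := singleton_of_add_eq_singleton (haQ.face c).nonempty
      (hR.face c).nonempty hv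
    have hqm : q ∈ maxFace (a • Q) c := hq ▸ rfl
    have hrm : r ∈ maxFace R c := hr ▸ rfl
    beta_reduce
    rw [(hαβ q hqm.1 r hrm.1 hvP).1, ← Set.smul_set_singleton, ← hq, maxFace_smul ha, smul_smul,
      inv_mul_cancel₀ ha.ne', one_smul]
  · have hu := huv.left_mem (haQ.add hR)
    have hv := huv.right_mem (haQ.add hR)
    obtain ⟨-, c, hc⟩ := huv
    have hc' := hc
    rw [haQ.maxFace_add hR] at hc'
    obtain ⟨q, hq, r, hr, rfl⟩ := Set.mem_add.1 (hc'.symm ▸ left_mem_segment ℝ u v)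
    obtain ⟨q', hq', r', hr', rfl⟩ := Set.mem_add.1 (hc'.symm ▸ right_mem_segment ℝ (q + r) v)
    have hmem : q' + r ∈ segment ℝ (q + r) (q' + r') := hc' ▸ Set.add_mem_add hq' hr
    rw [segment_eq_image'] at hmem
    obtain ⟨t, ht, hqr⟩ := hmem
    refine ⟨a⁻¹ * t, mul_nonneg (inv_pos.2 ha).le ht.1, ?_⟩
    beta_reduce at hqr ⊢
    rw [(hαβ q hq.1 r hr.1 hu).1, (hαβ q' hq'.1 r' hr'.1 hv).1, ← smul_sub, mul_smul]
    congr 1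
    rw [← add_sub_add_right_eq_sub q' q r, ← hqr]
    abel

lemma IsVertexMap.isEdgeDeformationVector {P Q : Set W} {f : W → W}
    (hf : IsVertexMap P Q f) {lam : Edge P → ℝ} (h0 : ∀ e, 0 ≤ lam e)
    (hlam : HasEdgeVector P f lam) : IsEdgeDeformationVector P Q lam :=
  ⟨fun v => f v, fun v c hv => hf v c hv, h0, hlam⟩

lemma IsVertexMap.apply_eq {A B : Set W} {f : W → W} (hA : IsPolytope A) (hB : IsPolytope B)
    (hf : IsVertexMap (A + B) A f) {p u x : W} (hp : p ∈ (A + B).exposedPoints ℝ) (hu : u ∈ A)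
    (hx : x ∈ B) (h : u + x = p) : f p = u := by
  obtain ⟨c, hc⟩ := mem_exposedPoints_iff.1 hp
  have h1 := hf p c hc
  rw [hA.maxFace_add hB] at hc
  obtain ⟨a, b, ha, hb, hab⟩ := singleton_of_add_eq_singleton (hA.face c).nonempty
    (hB.face c).nonempty hc
  have ham : a ∈ maxFace A c := ha ▸ rfl
  have hbm : b ∈ maxFace B c := hb ▸ rfl
  rw [h1, Set.singleton_eq_singleton_iff] at ha
  rw [ha]
  exact (add_unique_of_exposed hp ham.1 hbm.1 hu hx hab h).1

lemma IsVertexMap.apply_mem {A B : Set W} {f : W → W} (hA : IsPolytope A) (hB : IsPolytope B)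
    (hf : IsVertexMap (A + B) A f) {p : W} (hp : p ∈ (A + B).exposedPoints ℝ)
    {c : StrongDual ℝ W} (hpc : p ∈ maxFace (A + B) c) : f p ∈ maxFace A c := by
  rw [hA.maxFace_add hB] at hpc
  obtain ⟨a, ha, b, hb, hab⟩ := Set.mem_add.1 hpc
  rw [hf.apply_eq hA hB hp ha.1 hb.1 hab]
  exact ha

/-- Polytopes are determined by their faces in the directions generic for another polytope. -/
lemma IsPolytope.subset_of_vertexMap [FiniteDimensional ℝ W] {S A B : Set W} (hS : IsPolytope S)
    (hA : IsPolytope A) (hB : IsPolytope B) {f : W → W} (hfA : IsVertexMap S A f)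
    (hfB : IsVertexMap S B f) : A ⊆ B := by
  refine hA.subset_of_vertices hB.convex fun a ha => ?_
  obtain ⟨c, hc⟩ := mem_exposedPoints_iff.1 ha
  obtain ⟨c', x, h1, h2⟩ := exists_maxFace_eq_singleton hA hS (c := c) fun x y hxy => by
    rw [hc, vectorSpan_singleton, Submodule.mem_bot, sub_eq_zero]
    exact hxy.1.symm
  have h3 := hfA x c' h2
  have h4 := hfB x c' h2
  rw [h1, hc, Set.singleton_eq_singleton_iff] at h3
  rw [← h3] at h4
  exact (h4 ▸ rfl : a ∈ maxFace B c').1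

lemma IsIndecomposable.smul {P : Set W} (h : IsIndecomposable P) {c : ℝ} (hc : 0 < c) :
    IsIndecomposable (c • P) := by
  refine ⟨h.1.smul c, ?_, ?_⟩
  · obtain ⟨x, hx, y, hy, hxy⟩ := h.2.1
    exact ⟨c • x, Set.smul_mem_smul_set hx, c • y, Set.smul_mem_smul_set hy,
      fun he => hxy (smul_right_injective W hc.ne' he)⟩
  · rintro Q ⟨hQ, R, hR, a, ha, hE⟩
    obtain ⟨b, hb, t, rfl⟩ := h.2.2 Q ⟨hQ, c⁻¹ • R, hR.smul _, c⁻¹ * a,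
      mul_pos (inv_pos.2 hc) ha, by
        rw [mul_smul, ← smul_add, ← hE, smul_smul, inv_mul_cancel₀ hc.ne', one_smul]⟩
    refine ⟨b * c⁻¹, mul_nonneg hb (inv_pos.2 hc).le, t, ?_⟩
    rw [smul_smul, mul_assoc, inv_mul_cancel₀ hc.ne', mul_one]

lemma zero_smul_eq_singleton {P : Set W} (hP : P.Nonempty) : (0 : ℝ) • P = {0} := by
  rw [Set.zero_smul_set hP]
  rfl

lemma maxFace_sum_eq_singleton {ι : Type*} (s : Finset ι) {P : ι → Set W} {x : ι → W}
    {c : StrongDual ℝ W} (h : ∀ i ∈ s, maxFace (P i) c = {x i}) :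
    maxFace (∑ i ∈ s, P i) c = {∑ i ∈ s, x i} := by
  classical
  induction s using Finset.induction_on with
  | empty =>
    simp only [Finset.sum_empty]
    exact maxFace_singleton 0 c
  | insert i s hi ih =>
    have h1 := h i (by simp)
    have h2 := ih fun j hj => h j (by simp [hj])
    rw [Finset.sum_insert hi, Finset.sum_insert hi, maxFace_add (h1 ▸ Set.singleton_nonempty _)
      (h2 ▸ Set.singleton_nonempty _), h1, h2, Set.singleton_add_singleton]

omit [NormedSpace ℝ W] in
lemma sum_add_singleton {ι : Type*} (s : Finset ι) (P : ι → Set W) (t : ι → W) :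
    ∑ i ∈ s, (P i + {t i}) = (∑ i ∈ s, P i) + {∑ i ∈ s, t i} := by
  classical
  induction s using Finset.induction_on with
  | empty =>
    simp only [Finset.sum_empty]
    exact (add_zero (0 : Set W)).symm
  | insert i s hi ih =>
    rw [Finset.sum_insert hi, Finset.sum_insert hi, Finset.sum_insert hi, ih, add_add_add_comm,
      Set.singleton_add_singleton]

lemma sum_smul_convex {ι : Type*} (s : Finset ι) {P : Set W} (hP : Convex ℝ P) (hn : P.Nonempty)
    {μ : ι → ℝ} (hμ : ∀ i ∈ s, 0 ≤ μ i) : ∑ i ∈ s, μ i • P = (∑ i ∈ s, μ i) • P := by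
  classical
  induction s using Finset.induction_on with
  | empty =>
    rw [Finset.sum_empty, Finset.sum_empty, zero_smul_eq_singleton hn]
    rfl
  | insert i s hi ih =>
    have h : ∀ j ∈ s, 0 ≤ μ j := fun j hj => hμ j (by simp [hj])
    rw [Finset.sum_insert hi, Finset.sum_insert hi, ih h,
      hP.add_smul (hμ i (by simp)) (Finset.sum_nonneg h)]

lemma IsVertexMap.sum {r : ℕ} {S : Set W} {P : Fin r → Set W} {f : Fin r → W → W}
    (hP : ∀ i, IsPolytope (P i)) (hf : ∀ i, IsVertexMap S (P i) (f i)) {c : Fin r → ℝ}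
    (hc : ∀ i, 0 ≤ c i) (t : W) :
    IsVertexMap S ((∑ i, c i • P i) + {t}) (fun v => (∑ i, c i • f i v) + t) := by
  intro v η hη
  have h1 : maxFace (∑ i, c i • P i) η = {∑ i, c i • f i v} := by
    refine maxFace_sum_eq_singleton _ fun i _ => ?_
    have h := hf i v η hη
    rcases (hc i).eq_or_lt with h0 | h0
    · rw [← h0, zero_smul_eq_singleton (hP i).nonempty, maxFace_singleton, zero_smul]
    · rw [maxFace_smul h0, h, Set.smul_set_singleton]
  rw [maxFace_add (h1 ▸ Set.singleton_nonempty _) (by rw [maxFace_singleton]; exact ⟨t, rfl⟩),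
    h1, maxFace_singleton, Set.singleton_add_singleton]

/-! ### Families of indecomposable polytopes in parallelogramic position -/

omit [NormedSpace ℝ W] in
lemma sum_eq_add_sum_erase {r : ℕ} (P : Fin r → Set W) (i : Fin r) :
    ∑ j, P j = P i + ∑ j ∈ Finset.univ.erase i, P j :=
  (Finset.add_sum_erase _ _ (Finset.mem_univ i)).symm

section Family

variable {r : ℕ} {P : Fin r → Set W}

lemma isDeformation_summand (hP : ∀ i, IsPolytope (P i)) (i : Fin r) :
    IsDeformation (∑ j, P j) (P i) :=
  ⟨hP i, _, IsPolytope.sum _ fun j _ => hP j, 1, one_pos, by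
    rw [one_smul]; exact sum_eq_add_sum_erase P i⟩

/-- Each edge of the sum comes from exactly one of the summands. -/
lemma exists_edge_summand (hP : ∀ i, IsPolytope (P i)) (hpar : FamilyParallelogramicPosition P)
    {f : Fin r → W → W} (hf : ∀ i, IsVertexMap (∑ j, P j) (P i) (f i)) {p q : W}
    (hpq : IsEdge (∑ j, P j) p q) :
    ∃ i u v x c, u ≠ v ∧ maxFace (P i) c = segment ℝ u v ∧
      maxFace (∑ j ∈ Finset.univ.erase i, P j) c = {x} ∧ p = u + x ∧ q = v + x ∧
      f i p = u ∧ f i q = v ∧ ∀ j, j ≠ i → f j p = f j q := by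
  have hE : ∀ i, IsPolytope (∑ j ∈ Finset.univ.erase i, P j) := fun i =>
    IsPolytope.sum _ fun j _ => hP j
  have hS := IsPolytope.sum Finset.univ fun j _ => hP j
  have hpS := hpq.left_mem hS
  have hqS := hpq.right_mem hS
  obtain ⟨hne, c, hc⟩ := hpq
  have hcase := fun i => ((hpar i).transverse (hP i) (hE i)).edge_cases (hP i) (hE i) (c := c) hne
    ((sum_eq_add_sum_erase P i) ▸ hc)
  by_cases hex : ∃ i u v x, u ≠ v ∧ maxFace (P i) c = segment ℝ u v ∧
      maxFace (∑ j ∈ Finset.univ.erase i, P j) c = {x} ∧ p = u + x ∧ q = v + x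
  · obtain ⟨i, u, v, x, huv, hu, hx, hp, hq⟩ := hex
    have hum : u ∈ maxFace (P i) c := hu ▸ left_mem_segment ℝ u v
    have hvm : v ∈ maxFace (P i) c := hu ▸ right_mem_segment ℝ u v
    have hxm : x ∈ maxFace (∑ j ∈ Finset.univ.erase i, P j) c := hx ▸ rfl
    have hfi := sum_eq_add_sum_erase P i ▸ hf i
    refine ⟨i, u, v, x, c, huv, hu, hx, hp, hq, ?_, ?_, fun j hj => ?_⟩
    · exact hfi.apply_eq (hP i) (hE i) (sum_eq_add_sum_erase P i ▸ hpS) hum.1 hxm.1 hp.symm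
    · exact hfi.apply_eq (hP i) (hE i) (sum_eq_add_sum_erase P i ▸ hqS) hvm.1 hxm.1 hq.symm
    -- `P j` is a summand of the complement of `P i`, whose `c`-face is a point; so `f j` takes a
    -- single value on the edge.
    · have hsub : ∃ a, maxFace (P j) c = {a} := by
        have hR : IsPolytope (∑ k ∈ (Finset.univ.erase i).erase j, P k) :=
          IsPolytope.sum _ fun k _ => hP k
        rw [← Finset.add_sum_erase _ _ (Finset.mem_erase.2 ⟨hj, Finset.mem_univ j⟩),
          (hP j).maxFace_add hR] at hx
        obtain ⟨a, -, ha, -⟩ := singleton_of_add_eq_singleton ((hP j).face c).nonempty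
          (hR.face c).nonempty hx
        exact ⟨a, ha⟩
      obtain ⟨a, ha⟩ := hsub
      have hfj := sum_eq_add_sum_erase P j ▸ hf j
      have hval : ∀ w ∈ (∑ k, P k).exposedPoints ℝ, w ∈ maxFace (∑ k, P k) c → f j w = a :=
        fun w hw hwc => by
          have : f j w ∈ maxFace (P j) c :=
            hfj.apply_mem (hP j) (hE j) (sum_eq_add_sum_erase P j ▸ hw)
              (sum_eq_add_sum_erase P j ▸ hwc)
          rw [ha] at this
          exact this
      rw [hval p hpS (hc ▸ left_mem_segment ℝ p q), hval q hqS (hc ▸ right_mem_segment ℝ p q)]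
  · exfalso
    have hsing : ∀ i, ∃ u, maxFace (P i) c = {u} := fun i => by
      rcases hcase i with ⟨u, v, x, h⟩ | ⟨u, x, y, -, h, -⟩
      · exact absurd ⟨i, u, v, x, h⟩ hex
      · exact ⟨u, h⟩
    choose u hu using hsing
    have := maxFace_sum_eq_singleton Finset.univ fun i _ => hu i
    rw [hc] at this
    have h1 : p ∈ ({∑ i, u i} : Set W) := this ▸ left_mem_segment ℝ p q
    have h2 : q ∈ ({∑ i, u i} : Set W) := this ▸ right_mem_segment ℝ p q
    exact hne (h1.trans h2.symm)

/-- The framework deformations of the sum are the nonnegative combinations of the vertex maps of the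
summands, up to translation. -/
lemma exists_eq_sum_smul [FiniteDimensional ℝ W]
    (hP : ∀ i, IsIndecomposable (P i))
    (hpar : FamilyParallelogramicPosition P) {f : Fin r → W → W}
    (hf : ∀ i, IsVertexMap (∑ j, P j) (P i) (f i)) {ψ : W → W} (hψ : IsDefo (∑ j, P j) ψ) :
    ∃ c : Fin r → ℝ, (∀ i, 0 ≤ c i) ∧ ∃ t : W, ∀ p ∈ (∑ j, P j).exposedPoints ℝ,
      ψ p = (∑ i, c i • f i p) + t := by
  have hP' : ∀ i, IsPolytope (P i) := fun i => (hP i).1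
  have hE : ∀ i, IsPolytope (∑ j ∈ Finset.univ.erase i, P j) := fun i =>
    IsPolytope.sum _ fun j _ => hP' j
  have hS := IsPolytope.sum Finset.univ fun j _ => hP' j
  have hex : ∀ i, ∃ c : ℝ, 0 ≤ c ∧ ∀ u v x η, u ≠ v → maxFace (P i) η = segment ℝ u v →
      maxFace (∑ j ∈ Finset.univ.erase i, P j) η = {x} →
      ψ (v + x) - ψ (u + x) = c • (v - u) := by
    intro i
    obtain ⟨ψ', hψ', h⟩ := ((hpar i).transverse (hP' i) (hE i)).exists_isDefo_left (hP' i) (hE i)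
      (sum_eq_add_sum_erase P i ▸ hψ)
    obtain ⟨c, hc, t, hct⟩ := (hP i).exists_eq_smul_add hψ'
    refine ⟨c, hc, fun u v x η huv hu hx => ?_⟩
    have he : IsEdge (P i) u v := ⟨huv, η, hu⟩
    rw [h u v x η huv hu hx, hct u (he.left_mem (hP' i)), hct v (he.right_mem (hP' i)),
      add_sub_add_right_eq_sub, smul_sub]
  choose c hc hcψ using hex
  have hconst : ∀ p q, IsEdge (∑ j, P j) p q →
      ψ p - ∑ i, c i • f i p = ψ q - ∑ i, c i • f i q := by
    intro p q hpq
    obtain ⟨i, u, v, x, η, huv, hu, hx, hp, hq, hfp, hfq, hj⟩ :=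
      exists_edge_summand hP' hpar hf hpq
    have h1 := hcψ i u v x η huv hu hx
    rw [← hp, ← hq] at h1
    have h2 : ∑ j, c j • f j q - ∑ j, c j • f j p = c i • (v - u) := by
      rw [← Finset.sum_sub_distrib, Finset.sum_eq_single i, hfp, hfq, smul_sub]
      · intro j _ hji
        rw [hj j hji, sub_self]
      · simp
    have : ψ p - ∑ i, c i • f i p - (ψ q - ∑ i, c i • f i q) =
        (∑ j, c j • f j q - ∑ j, c j • f j p) - (ψ q - ψ p) := by abel
    rw [← sub_eq_zero, this, h1, h2, sub_self]
  obtain ⟨z, hz⟩ := hS.exposedPoints_nonempty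
  refine ⟨c, hc, ψ z - ∑ i, c i • f i z, fun p hp => ?_⟩
  -- With `c = 0` and `a = -1` the open half-space is everything.
  have := hS.eq_of_const_on_edges (f := fun p => ψ p - ∑ i, c i • f i p) (c := 0) (a := -1)
    (fun u v huv _ _ => hconst u v huv) hp hz (by simp) (by simp)
  beta_reduce at this
  rw [← this]
  abel

lemma HasEdgeVector.sum_smul {S : Set W} {f : Fin r → W → W} {b : Fin r → Edge S → ℝ}
    (hb : ∀ i, HasEdgeVector S (f i) (b i)) (c : Fin r → ℝ) (t : W) :
    HasEdgeVector S (fun p => (∑ i, c i • f i p) + t) (∑ i, c i • b i) := by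
  intro u v h
  rw [add_sub_add_right_eq_sub, ← Finset.sum_sub_distrib, Finset.sum_apply, Finset.sum_smul]
  refine Finset.sum_congr rfl fun i _ => ?_
  rw [← smul_sub, ← hb i u v h, smul_smul]
  rfl

/-- For each summand there is an edge of the sum which is only deformed by that summand. -/
lemma exists_indicator_edge [FiniteDimensional ℝ W]
    (hP : ∀ i, IsIndecomposable (P i))
    (hpar : FamilyParallelogramicPosition P) {f : Fin r → W → W}
    (hf : ∀ i, IsVertexMap (∑ j, P j) (P i) (f i)) {b : Fin r → Edge (∑ j, P j) → ℝ}
    (hb : ∀ i, HasEdgeVector (∑ j, P j) (f i) (b i)) (i : Fin r) :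
    ∃ g, ∀ c : Fin r → ℝ, (∑ j, c j • b j) g = c i := by
  have hP' : ∀ i, IsPolytope (P i) := fun i => (hP i).1
  have hE : ∀ i, IsPolytope (∑ j ∈ Finset.univ.erase i, P j) := fun i =>
    IsPolytope.sum _ fun j _ => hP' j
  have hS := IsPolytope.sum Finset.univ fun j _ => hP' j
  have hedge : ∃ u v, IsEdge (P i) u v := by
    by_contra! hcon
    obtain ⟨v, hv⟩ := (hP' i).eq_singleton_of_no_edge hcon
    have := (hP i).2.1
    rw [hv] at this
    exact Set.not_nontrivial_singleton this
  obtain ⟨u, v, huv⟩ := hedge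
  obtain ⟨η, x, hη, hx⟩ := ((hpar i).transverse (hP' i) (hE i)).exists_vertex_over_edge (hP' i)
    (hE i) huv
  have hpq : IsEdge (∑ j, P j) (u + x) (v + x) :=
    sum_eq_add_sum_erase P i ▸ isEdge_add_right huv.1 hη hx
  obtain ⟨k, u', v', x', η', huv', -, -, hp, hq, hfp, hfq, hj⟩ :=
    exists_edge_summand hP' hpar hf hpq
  have hum : u ∈ maxFace (P i) η := hη ▸ left_mem_segment ℝ u v
  have hvm : v ∈ maxFace (P i) η := hη ▸ right_mem_segment ℝ u v
  have hxm : x ∈ maxFace (∑ j ∈ Finset.univ.erase i, P j) η := hx ▸ rfl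
  have hfi := sum_eq_add_sum_erase P i ▸ hf i
  have e1 : f i (u + x) = u := hfi.apply_eq (hP' i) (hE i)
    (sum_eq_add_sum_erase P i ▸ hpq.left_mem hS) hum.1 hxm.1 rfl
  have e2 : f i (v + x) = v := hfi.apply_eq (hP' i) (hE i)
    (sum_eq_add_sum_erase P i ▸ hpq.right_mem hS) hvm.1 hxm.1 rfl
  -- The map `f i` separates the endpoints, so the summand responsible for this edge is `P i`.
  have hik : i = k := by
    by_contra hik
    have := hj i hik
    rw [e1, e2] at this
    exact huv.1 this
  subst hik
  have hadj : (edgeGraph (∑ j, P j)).Adj ⟨_, hpq.left_mem hS⟩ ⟨_, hpq.right_mem hS⟩ :=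
    adj_iff.2 hpq
  refine ⟨mkEdge hadj, fun c => ?_⟩
  have key := HasEdgeVector.sum_smul hb c 0 _ _ hadj
  refine smul_left_injective ℝ (sub_ne_zero.2 hpq.1.symm) (key.trans ?_)
  beta_reduce
  rw [add_sub_add_right_eq_sub, ← Finset.sum_sub_distrib, Finset.sum_eq_single i]
  · rw [e1, e2, add_sub_add_right_eq_sub, smul_sub]
  · intro j _ hji
    rw [hj j hji, sub_self]
  · simp

/-- The deformation cone of a sum of indecomposable polytopes in parallelogramic position, and the
decompositions of its deformations. -/
theorem FamilyParallelogramicPosition.decomposition [FiniteDimensional ℝ W]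
    (hP : ∀ i, IsIndecomposable (P i))
    (hpar : FamilyParallelogramicPosition P) :
    (defoCone (∑ i, P i)).IsSimplicial ∧
      Module.finrank ℝ (Submodule.span ℝ (defoCone (∑ i, P i) : Set (Edge (∑ i, P i) → ℝ))) = r ∧
      (∃ b : Fin r → Edge (∑ i, P i) → ℝ,
        (∀ i, IsDeformation (∑ j, P j) (P i)) ∧
        (∀ i, IsEdgeDeformationVector (∑ j, P j) (P i) (b i)) ∧
        LinearIndependent ℝ b ∧
        PointedCone.hull ℝ (Set.range b) = defoCone (∑ i, P i)) ∧
      ∀ Q, IsDeformation (∑ i, P i) Q →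
        ∃ c : Fin r → ℝ, (∀ i, 0 ≤ c i) ∧ (∃ t, Q = (∑ i, c i • P i) + {t}) ∧
          (∀ i, 0 < c i → IsIndecomposable (c i • P i)) ∧
          (∀ c' : Fin r → ℝ, (∀ i, 0 ≤ c' i) → (∃ t, Q = (∑ i, c' i • P i) + {t}) → c' = c) ∧
          (∀ (m : ℕ) (R : Fin m → Set W),
            (∀ j, IsIndecomposable (R j)) → (∃ t, Q = (∑ j, R j) + {t}) →
            ∃ (σ : Fin m → Fin r) (μ : Fin m → ℝ),
              (∀ j, 0 < μ j ∧ ∃ t, R j = μ j • P (σ j) + {t}) ∧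
              ∀ i, ∑ j with σ j = i, μ j = c i) := by
  have hP' : ∀ i, IsPolytope (P i) := fun i => (hP i).1
  have hS := IsPolytope.sum Finset.univ fun j _ => hP' j
  have hdefo := isDeformation_summand hP'
  choose f hf hfd using fun i => (hdefo i).exists_vertexMap
  choose b hb0 hb using fun i => (hfd i).exists_hasEdgeVector
  choose g hg using exists_indicator_edge hP hpar hf hb
  have hli : LinearIndependent ℝ b := by
    rw [Fintype.linearIndependent_iff]
    intro c hc i
    rw [← hg i c, hc]
    rfl
  have hhull : PointedCone.hull ℝ (Set.range b) = defoCone (∑ i, P i) := by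
    apply le_antisymm
    · rw [PointedCone.hull, Submodule.span_le]
      rintro _ ⟨i, rfl⟩
      exact (mem_defoCone_iff hS).2 ⟨f i, hfd i, hb i⟩
    · intro lam hlam
      obtain ⟨ψ, hψ, hψlam⟩ := (mem_defoCone_iff hS).1 hlam
      obtain ⟨c, hc, t, hct⟩ := exists_eq_sum_smul hP hpar hf hψ
      have : lam = ∑ i, c i • b i :=
        hψlam.unique ((HasEdgeVector.sum_smul hb c t).congr hct)
      rw [this]
      refine Submodule.sum_mem _ fun i _ => ?_
      exact Submodule.smul_mem _ (⟨c i, hc i⟩ : {a : ℝ // 0 ≤ a})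
        (Submodule.subset_span ⟨i, rfl⟩)
  have hrep : ∀ Q, IsDeformation (∑ i, P i) Q →
      ∃ c : Fin r → ℝ, (∀ i, 0 ≤ c i) ∧ ∃ t, Q = (∑ i, c i • P i) + {t} := by
    intro Q hQ
    obtain ⟨φ, hφ, hφd⟩ := hQ.exists_vertexMap
    obtain ⟨c, hc, t, hct⟩ := exists_eq_sum_smul hP hpar hf hφd
    have hR : IsPolytope ((∑ i, c i • P i) + {t}) :=
      (IsPolytope.sum _ fun i _ => (hP' i).smul _).add (IsPolytope.singleton t)
    have hφ' : IsVertexMap (∑ i, P i) ((∑ i, c i • P i) + {t}) φ := fun v η hv => by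
      rw [hct v (mem_exposedPoints_iff.2 ⟨η, hv⟩)]
      exact IsVertexMap.sum hP' hf hc t v η hv
    -- Both polytopes have the same vertex map from the sum, hence coincide.
    exact ⟨c, hc, t, Set.Subset.antisymm (hS.subset_of_vertexMap hQ.1 hR hφ hφ')
      (hS.subset_of_vertexMap hR hQ.1 hφ' hφ)⟩
  have huniq : ∀ c c' : Fin r → ℝ, (∀ i, 0 ≤ c i) → (∀ i, 0 ≤ c' i) → ∀ t t' : W,
      (∑ i, c i • P i) + {t} = (∑ i, c' i • P i) + {t'} → c' = c := by
    intro c c' hc hc' t t' h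
    have h1 := IsVertexMap.sum hP' hf hc t
    have h2 := IsVertexMap.sum hP' hf hc' t'
    rw [h] at h1
    have hsum : ∑ i, c i • b i = ∑ i, c' i • b i := by
      refine (HasEdgeVector.sum_smul hb c t).unique
        ((HasEdgeVector.sum_smul hb c' t').congr fun v hv => ?_)
      obtain ⟨η, hη⟩ := mem_exposedPoints_iff.1 hv
      exact Set.singleton_injective ((h1 v η hη).symm.trans (h2 v η hη))
    funext i
    rw [← hg i c, ← hg i c', hsum]
  refine ⟨⟨Set.range b, Set.finite_range b, hli.linearIndepOn_id, hhull⟩, ?_, ⟨b, hdefo,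
    fun i => (hf i).isEdgeDeformationVector (hb0 i) (hb i), hli, hhull⟩, fun Q hQ => ?_⟩
  · rw [← hhull]
    have : Submodule.span ℝ (PointedCone.hull ℝ (Set.range b) : Set (Edge (∑ i, P i) → ℝ)) =
        Submodule.span ℝ (Set.range b) := Submodule.span_span_of_tower _ _ _
    rw [this, finrank_span_eq_card hli, Fintype.card_fin]
  obtain ⟨c, hc, t, hQt⟩ := hrep Q hQ
  refine ⟨c, hc, ⟨t, hQt⟩, fun i hi => (hP i).smul hi, fun c' hc' ⟨t', ht'⟩ =>
    huniq c c' hc hc' t t' (hQt.symm.trans ht'), fun m R hR ⟨s, hs⟩ => ?_⟩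
  -- A summand of `Q` is again a deformation of the whole sum, so `R j` is a combination of the `P
  -- i`. Some coefficient is positive, as `R j` is not a point; then `P i` is a deformation of the
  -- indecomposable `R j`, hence a dilate of it.
  have hdil : ∀ j, ∃ i, ∃ μ : ℝ, 0 < μ ∧ ∃ t, R j = μ • P i + {t} := by
    intro j
    obtain ⟨-, R', hR', a, ha, hSQ⟩ := hQ
    have hRP : IsPolytope (∑ k ∈ Finset.univ.erase j, R k) :=
      IsPolytope.sum _ fun k _ => (hR k).1
    have hRj : IsDeformation (∑ i, P i) (R j) := by
      refine ⟨(hR j).1, a • ((∑ k ∈ Finset.univ.erase j, R k) + {s}) + R',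
        ((hRP.add (IsPolytope.singleton s)).smul a).add hR', a, ha, ?_⟩
      rw [hSQ, hs, sum_eq_add_sum_erase R j, ← add_assoc, ← smul_add, add_assoc (R j)]
    obtain ⟨e, he, t₁, ht₁⟩ := hrep _ hRj
    obtain ⟨i, hi⟩ : ∃ i, 0 < e i := by
      by_contra! hcon
      have : ∑ i, e i • P i = 0 := Finset.sum_eq_zero fun i _ => by
        rw [le_antisymm (hcon i) (he i), zero_smul_eq_singleton (hP' i).nonempty]
        rfl
      rw [this, zero_add] at ht₁
      have hnt := (hR j).2.1
      rw [ht₁] at hnt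
      exact Set.not_nontrivial_singleton hnt
    obtain ⟨a', ha', t₂, ht₂⟩ := (hR j).2.2 (P i)
      ⟨hP' i, (∑ k ∈ Finset.univ.erase i, e k • P k) + {t₁},
        (IsPolytope.sum _ fun k _ => (hP' k).smul _).add (IsPolytope.singleton t₁), e i, hi, by
          rw [ht₁, sum_eq_add_sum_erase _ i, add_assoc]⟩
    have ha0 : a' ≠ 0 := by
      rintro rfl
      have hnt := (hP i).2.1
      rw [ht₂, zero_smul_eq_singleton (hR j).1.nonempty, Set.singleton_add_singleton] at hnt
      exact Set.not_nontrivial_singleton hnt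
    refine ⟨i, a'⁻¹, inv_pos.2 (lt_of_le_of_ne ha' ha0.symm), -(a'⁻¹ • t₂), ?_⟩
    rw [ht₂, smul_add, smul_smul, inv_mul_cancel₀ ha0, one_smul, Set.smul_set_singleton,
      add_assoc, Set.singleton_add_singleton, add_neg_cancel]
    exact (add_zero (R j)).symm
  choose σ μ hμ τ hτ using hdil
  refine ⟨σ, μ, fun j => ⟨hμ j, τ j, hτ j⟩, ?_⟩
  have hμ0 : ∀ i, 0 ≤ ∑ j with σ j = i, μ j := fun i => Finset.sum_nonneg fun j _ => (hμ j).le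
  -- Dilates of one convex set add by adding their factors, so grouping along the fibres of `σ`
  -- reduces to uniqueness of the coefficients.
  have hsum : Q = (∑ i, (∑ j with σ j = i, μ j) • P i) + {(∑ j, τ j) + s} := by
    have h1 : ∑ j, R j = ∑ j, (μ j • P (σ j) + {τ j}) := Finset.sum_congr rfl fun j _ => hτ j
    have h2 : ∑ j, μ j • P (σ j) = ∑ i, (∑ j with σ j = i, μ j) • P i := by
      rw [← Finset.sum_fiberwise Finset.univ σ]
      refine Finset.sum_congr rfl fun i _ => ?_
      rw [← sum_smul_convex _ (hP' i).convex (hP' i).nonempty fun j _ => (hμ j).le]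
      refine Finset.sum_congr rfl fun j hj => ?_
      rw [(Finset.mem_filter.1 hj).2]
    rw [hs, h1, sum_add_singleton, h2, add_assoc, Set.singleton_add_singleton]
  have := huniq c _ hc hμ0 _ _ (hQt.symm.trans hsum)
  exact congrFun this

end Family

end PolytopeDeformation

theorem mainTheorem8 (d : ℕ) :
    -- Two polytopes in parallelogramic position
    (∀ P Q : Set (EuclideanSpace ℝ (Fin d)), IsPolytope P → IsPolytope Q →
      ParallelogramicPosition P Q →
      -- the deformation cone of the sum is the product of the deformation cones
      ConesLinearlyIsomorphic (defoCone (P + Q))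
        (Submodule.prod (defoCone P) (defoCone Q) :
          PointedCone ℝ ((Edge P → ℝ) × (Edge Q → ℝ))) ∧
      -- the edge classes are the classes of an equivalence relation on the edges of the sum,
      -- and the graph of edge dependencies is the lift for it
      ∃ (s : Setoid (Edge (P + Q))) (φ : Quotient s ≃ Edge P ⊕ Edge Q),
        (∀ a : Edge P ⊕ Edge Q, {g | φ (Quotient.mk s g) = a} = edgeClass P Q a) ∧
        dependencyGraph (P + Q) =
          LoopGraph.lift s
            (LoopGraph.relabel φ (LoopGraph.union (dependencyGraph P) (dependencyGraph Q)))) ∧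
    -- Families of indecomposable polytopes in parallelogramic position
    (∀ (r : ℕ) (P : Fin r → Set (EuclideanSpace ℝ (Fin d))), (∀ i, IsIndecomposable (P i)) →
      FamilyParallelogramicPosition P →
      -- the deformation cone is simplicial of dimension `r`
      (defoCone (∑ i, P i)).IsSimplicial ∧
      Module.finrank ℝ (Submodule.span ℝ (defoCone (∑ i, P i) : Set (Edge (∑ i, P i) → ℝ))) = r ∧
      -- its rays are spanned by the edge-deformation vectors of the `P i`
      (∃ b : Fin r → Edge (∑ i, P i) → ℝ,
        (∀ i, IsDeformation (∑ j, P j) (P i)) ∧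
        (∀ i, IsEdgeDeformationVector (∑ j, P j) (P i) (b i)) ∧
        LinearIndependent ℝ b ∧
        PointedCone.hull ℝ (Set.range b) = defoCone (∑ i, P i)) ∧
      -- every deformation decomposes uniquely as a sum of indecomposable polytopes,
      -- which are dilations of the `P i`
      ∀ Q, IsDeformation (∑ i, P i) Q →
        ∃ c : Fin r → ℝ, (∀ i, 0 ≤ c i) ∧ (∃ t, Q = (∑ i, c i • P i) + {t}) ∧
          (∀ i, 0 < c i → IsIndecomposable (c i • P i)) ∧
          (∀ c' : Fin r → ℝ, (∀ i, 0 ≤ c' i) → (∃ t, Q = (∑ i, c' i • P i) + {t}) → c' = c) ∧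
          (∀ (m : ℕ) (R : Fin m → Set (EuclideanSpace ℝ (Fin d))),
            (∀ j, IsIndecomposable (R j)) → (∃ t, Q = (∑ j, R j) + {t}) →
            ∃ (σ : Fin m → Fin r) (μ : Fin m → ℝ),
              (∀ j, 0 < μ j ∧ ∃ t, R j = μ j • P (σ j) + {t}) ∧
              ∀ i, ∑ j with σ j = i, μ j = c i)) :=
  ⟨fun _ _ hP hQ h => h.defoCone_add hP hQ, fun _ _ hP h => h.decomposition hP⟩
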